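/- All digraphs are reflexive. For $n\ge 3$, an $n$-cycle is a reflexive digraph on $\{0,\dots,n-1\}$ in which, for each $i$ (modulo $n$), one or both of the arcs $(i,i+1)$, $(i+1,i)$ are present, and there are no other arcs between distinct vertices. A path of length $k$ is a reflexive digraph on $\{0,\dots,k\}$ in which, for each $0\le i<k$, one or both of the arcs $(i,i+1)$, $(i+1,i)$ are present, and there are no other arcs between distinct vertices. The product $\prod_i\mathbb{Q}_i$ of digraphs has as vertices the tuples $(x_i)_i$ with $x_i$ a vertex of $\mathbb{Q}_i$, and $(x,y)$ is an arc if and only if $(x_i,y_i)$ is an arc of $\mathbb{Q}_i$ for every $i$. An $n$-cycle $\mathbb{G}$ *satisfies the path condition* if there do not exist finitely many paths $\mathbb{Q}_1,\dots,\mathbb{Q}_m$ of length $n-2$, each isomorphic to an induced subdigraph of $\mathbb{G}$, together with a surjective homomorphism $\prod_i\mathbb{Q}_i\to\mathbb{G}$; otherwise it *fails* the path condition. For a word $W=x_1\cdots x_k$ ($k\ge 3$) on the alphabet $\{+,-,*\}$, let $C(W)$ be the $k$-cycle in which the arcs between $i-1$ and $i$ (modulo $k$) are $(i-1,i)$ only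 if $x_i=+$, $(i,i-1)$ only if $x_i=-$, and both if $x_i=*$; write $\mathbb{G}=C(W)$ if $\mathbb{G}$ is isomorphic to $C(W)$. **Theorem.** Let $n\ge 4$ and let $\mathbb{G}$ be an $n$-cycle that fails the path condition. Then there exist (possibly empty) words $A$ and $B$ on $\{+,-,*\}$ such that $$\mathbb{G}=C(A{*}{*}B{+})=C(A{+}B{*}{*})=C(A{-}B{*}{*}).$$ -/

import Mathlib

namespace ReflexiveCycles

/-- The alphabet `{+, -, *}`. -/
inductive Letter where
  | plus
  | minus
  | star
  deriving DecidableEq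

/-- A word on `{+, -, *}`; concatenation is `++`. -/
abbrev Word := List Letter

/-- A path of length `k`: a reflexive digraph on `{0, …, k}` in which two distinct vertices are
joined by one or both of the two possible arcs exactly when they are consecutive. -/
structure IsPath (k : ℕ) (P : Digraph (Fin (k + 1))) : Prop where
  refl : ∀ i, P.Adj i i
  adj_iff : ∀ i j : Fin (k + 1), i ≠ j →
    ((P.Adj i j ∨ P.Adj j i) ↔ ((i : ℕ) + 1 = j ∨ (j : ℕ) + 1 = i))

/-- An `n`-cycle, `n ≥ 3`: a reflexive digraph on `{0, …, n - 1}` in which two distinct vertices are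
joined by one or both of the two possible arcs exactly when they are consecutive modulo `n`. -/
structure IsCycle (n : ℕ) (G : Digraph (Fin n)) : Prop where
  three_le : 3 ≤ n
  refl : ∀ i, G.Adj i i
  adj_iff : ∀ i j : Fin n, i ≠ j →
    ((G.Adj i j ∨ G.Adj j i) ↔ (((i : ℕ) + 1) % n = j ∨ ((j : ℕ) + 1) % n = i))

/-- The reflexive digraph `C(W)` on `{0, …, |W| - 1}`: the letter of `W` in position `i`
(counting from `0`) describes the arcs between `i` and `i + 1` modulo `|W|`; it is `+` for the arc
`i → i + 1` alone, `-` for the arc `i + 1 → i` alone, and `*` for both arcs. -/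
def cycleOfWord (W : Word) : Digraph (Fin W.length) where
  Adj i j := i = j
    ∨ (((i : ℕ) + 1) % W.length = j ∧ (W.get i = Letter.plus ∨ W.get i = Letter.star))
    ∨ (((j : ℕ) + 1) % W.length = i ∧ (W.get j = Letter.minus ∨ W.get j = Letter.star))

/-- The digraph `G` is, up to isomorphism, the cycle `C(W)`. -/
def IsCycleOf {V : Type*} (G : Digraph V) (W : Word) : Prop :=
  Nonempty (G.Adj ≃r (cycleOfWord W).Adj)

/-- The product of a family of digraphs. -/
def prodDigraph {ι : Type*} {V : ι → Type*} (Q : (i : ι) → Digraph (V i)) :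
    Digraph ((i : ι) → V i) where
  Adj x y := ∀ i, (Q i).Adj (x i) (y i)

/-- The path condition for a digraph `G` on `n` vertices (used for `n`-cycles): there is no
homomorphism onto `G` from a product of finitely many paths of length `n - 2`, each of which is
isomorphic to an induced subdigraph of `G`. -/
def PathCondition (n : ℕ) (G : Digraph (Fin n)) : Prop :=
  ¬ ∃ (m : ℕ) (Q : Fin m → Digraph (Fin (n - 2 + 1))),
      (∀ i, IsPath (n - 2) (Q i)) ∧
      (∀ i, Nonempty ((Q i).Adj ↪r G.Adj)) ∧
      ∃ f : (prodDigraph Q).Adj →r G.Adj, Function.Surjective f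

end ReflexiveCycles

namespace ReflexiveCycles

/-! ### Words and direction patterns -/

/-- The one-way letter of a given direction. -/
def lit : Bool → Letter
  | true => .plus
  | false => .minus

/-- Reversal of the direction of a letter. -/
def Letter.flip : Letter → Letter
  | .plus => .minus
  | .minus => .plus
  | .star => .star

/-- The letter `c` can be traversed in the direction `y`. -/
def Letter.Compat (c : Letter) (y : Bool) : Prop := c = .star ∨ c = lit y

/-- The number of letters other than `*`. -/
def nonstars (q : Word) : ℕ := q.countP (· ≠ .star)

/-- Greedy embedding of a word into a pattern of directions, `*` matching both directions. -/
def Emb : Word → List Bool → Prop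
  | [], _ => True
  | _ :: _, [] => False
  | c :: q, y :: w => (c.Compat y ∧ Emb q w) ∨ (¬ c.Compat y ∧ Emb (c :: q) w)

@[simp] theorem emb_nil (w : List Bool) : Emb [] w := by
  cases w <;> simp [Emb]

@[simp] theorem not_emb_cons_nil (c : Letter) (q : Word) : ¬ Emb (c :: q) [] := by
  simp [Emb]

theorem emb_cons_of_compat {c : Letter} {q : Word} {y : Bool} {w : List Bool} (h : c.Compat y) :
    Emb (c :: q) (y :: w) ↔ Emb q w := by
  simp [Emb, h]

theorem emb_cons_of_not_compat {c : Letter} {q : Word} {y : Bool} {w : List Bool}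
    (h : ¬ c.Compat y) : Emb (c :: q) (y :: w) ↔ Emb (c :: q) w := by
  simp [Emb, h]

@[simp] theorem star_compat (y : Bool) : Letter.star.Compat y := Or.inl rfl

@[simp] theorem lit_compat (a y : Bool) : (lit a).Compat y ↔ a = y := by
  cases a <;> cases y <;> simp [Letter.Compat, lit]

theorem lit_ne_star (a : Bool) : lit a ≠ .star := by cases a <;> simp [lit]

theorem lit_injective : Function.Injective lit := by
  intro a b; cases a <;> cases b <;> simp [lit]

theorem Letter.eq_star_or_lit (c : Letter) : c = .star ∨ ∃ a, c = lit a := by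
  cases c
  · exact Or.inr ⟨true, rfl⟩
  · exact Or.inr ⟨false, rfl⟩
  · exact Or.inl rfl

@[simp] theorem nonstars_nil : nonstars [] = 0 := rfl

@[simp] theorem nonstars_star (q : Word) : nonstars (.star :: q) = nonstars q := by
  simp [nonstars]

@[simp] theorem nonstars_lit (a : Bool) (q : Word) :
    nonstars (lit a :: q) = nonstars q + 1 := by
  simp [nonstars, lit_ne_star]

@[simp] theorem nonstars_append (p q : Word) : nonstars (p ++ q) = nonstars p + nonstars q := by
  simp [nonstars]

@[simp] theorem nonstars_replicate (k : ℕ) : nonstars (List.replicate k .star) = 0 := by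
  induction k with
  | zero => rfl
  | succ k ih => rw [List.replicate_succ, nonstars_star, ih]

theorem nonstars_le_of_sublist {p q : Word} (h : p.Sublist q) : nonstars p ≤ nonstars q :=
  h.countP_le

theorem emb_tail {c : Letter} {q : Word} : ∀ {w : List Bool}, Emb (c :: q) w → Emb q w
  | [], h => by simp at h
  | y :: w, h => by
    rcases q with _ | ⟨d, q⟩
    · simp
    rcases h with ⟨_, h⟩ | ⟨_, h⟩
    · by_cases hd : d.Compat y
      · rw [emb_cons_of_compat hd]; exact emb_tail h
      · rwa [emb_cons_of_not_compat hd]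
    · by_cases hd : d.Compat y
      · rw [emb_cons_of_compat hd]; exact emb_tail (emb_tail h)
      · rw [emb_cons_of_not_compat hd]; exact emb_tail h

theorem emb_cons_right {q : Word} {w : List Bool} (y : Bool) (h : Emb q w) : Emb q (y :: w) := by
  rcases q with _ | ⟨c, q⟩
  · simp
  by_cases hc : c.Compat y
  · rw [emb_cons_of_compat hc]; exact emb_tail h
  · rwa [emb_cons_of_not_compat hc]

/-- The greedy strategy is optimal, so additional directions never hurt. -/
theorem emb_mono {w v : List Bool} (h : w.Sublist v) : ∀ {q : Word}, Emb q w → Emb q v := by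
  induction h with
  | slnil => exact fun h => h
  | cons y _ ih => exact fun h => emb_cons_right y (ih h)
  | cons_cons y _ ih =>
    intro q h
    rcases q with _ | ⟨c, q⟩
    · simp
    rcases h with ⟨hc, h⟩ | ⟨hc, h⟩
    · exact (emb_cons_of_compat hc).2 (ih h)
    · exact (emb_cons_of_not_compat hc).2 (ih h)

theorem emb_prefix {p : Word} : ∀ {q : Word} {w : List Bool}, Emb (p ++ q) w → Emb p w := by
  induction p with
  | nil => simp
  | cons c p ih =>
    intro q w h
    induction w with
    | nil => simp at h
    | cons y w ihw =>
      rcases h with ⟨hc, h⟩ | ⟨hc, h⟩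
      · exact (emb_cons_of_compat hc).2 (ih h)
      · exact (emb_cons_of_not_compat hc).2 (ihw h)

/-! ### Patterns avoiding a word, and the words that fail on them -/

/-- A letter together with a chosen direction for each `*`. -/
inductive Tok where
  | lit (a : Bool)
  | st (s : Bool)

/-- The letter underlying a token. -/
def Tok.letter : Tok → Letter
  | .lit a => ReflexiveCycles.lit a
  | .st _ => .star

/-- The letters of a list of tokens. -/
def letters (ts : List Tok) : Word := ts.map Tok.letter

@[simp] theorem letters_nil : letters [] = [] := rfl
@[simp] theorem letters_lit (a : Bool) (ts : List Tok) :
    letters (.lit a :: ts) = lit a :: letters ts := rfl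
@[simp] theorem letters_st (s : Bool) (ts : List Tok) :
    letters (.st s :: ts) = .star :: letters ts := rfl
@[simp] theorem letters_append (p q : List Tok) : letters (p ++ q) = letters p ++ letters q := by
  simp [letters]
@[simp] theorem length_letters (p : List Tok) : (letters p).length = p.length := by
  simp [letters]

/-- A pattern into which the letters of `ts` do not embed, and which is, for large `N` and up to the
choice of the directions, as rich as possible. -/
def avoiding (N : ℕ) : List Tok → List Bool
  | [] => []
  | [.lit a] => List.replicate N (!a)
  | [.st _] => []
  | .lit a :: t :: ts => List.replicate N (!a) ++ a :: avoiding N (t :: ts)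
  | .st s :: t :: ts => s :: avoiding N (t :: ts)

theorem emb_lit_replicate (a : Bool) (q : Word) (w : List Bool) (N : ℕ) :
    Emb (lit a :: q) (List.replicate N (!a) ++ w) ↔ Emb (lit a :: q) w := by
  induction N with
  | zero => simp
  | succ N ih => rw [List.replicate_succ, List.cons_append, emb_cons_of_not_compat (by simp), ih]

/-- The greedy embedding uses exactly one direction from the piece belonging to each token, and the
piece of the last token offers nothing that its letter can use. -/
theorem not_emb_avoiding (N : ℕ) : ∀ ts : List Tok, ts ≠ [] → ¬ Emb (letters ts) (avoiding N ts)
  | [], h => absurd rfl h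
  | [.lit a], _ => by
    have := emb_lit_replicate a [] [] N
    simp only [List.append_nil, not_emb_cons_nil, iff_false] at this
    simpa [avoiding] using this
  | [.st _], _ => by simp [avoiding]
  | .lit a :: t :: ts, _ => by
    rw [avoiding, letters_lit, emb_lit_replicate, emb_cons_of_compat (by simp)]
    exact not_emb_avoiding N (t :: ts) (by simp)
  | .st s :: t :: ts, _ => by
    rw [avoiding, letters_st, emb_cons_of_compat (by simp)]
    exact not_emb_avoiding N (t :: ts) (by simp)

theorem avoiding_sublist (N : ℕ) : ∀ ts : List Tok, (avoiding N ts).Sublist (avoiding (N + 1) ts)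
  | [] => by simp [avoiding]
  | [.lit a] => by
    simp only [avoiding, List.replicate_succ]; exact List.sublist_cons_self _ _
  | [.st _] => by simp [avoiding]
  | .lit a :: t :: ts => by
    simp only [avoiding, List.replicate_succ, List.cons_append]
    exact ((List.Sublist.refl _).append ((avoiding_sublist N (t :: ts)).cons_cons a)).cons _
  | .st s :: t :: ts => by
    simp only [avoiding]; exact (avoiding_sublist N (t :: ts)).cons_cons s

/-- The run of the greedy embedding of a word into `avoiding N ts` for large `N`, when it leaves the
pattern. -/
inductive Fail : List Tok → Word → Prop
  | nil (q : Word) : Fail [] q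
  | hit {a : Bool} {ts : List Tok} {q : Word} (h : Fail ts q) : Fail (.lit a :: ts) (lit a :: q)
  | stay {a : Bool} {c : Letter} {ts : List Tok} {q : Word} (hc : c ≠ lit a)
      (h : Fail (.lit a :: ts) q) : Fail (.lit a :: ts) (c :: q)
  | takeStar {s : Bool} {ts : List Tok} {q : Word} (h : Fail ts q) :
      Fail (.st s :: ts) (.star :: q)
  | takeLit {s : Bool} {ts : List Tok} {q : Word} (h : Fail ts q) :
      Fail (.st s :: ts) (lit s :: q)
  | skip {s : Bool} {ts : List Tok} {q : Word} (h : Fail ts (lit (!s) :: q)) :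
      Fail (.st s :: ts) (lit (!s) :: q)

theorem compat_not_of_ne_lit {c : Letter} {a : Bool} (h : c ≠ lit a) : c.Compat (!a) := by
  cases c <;> cases a <;> simp_all [Letter.Compat, lit]

/-- With `N ≥ q.length`, a block of `N` equal directions cannot be exhausted by `q`. A letter other
than `lit a` thus always advances inside the block of `lit a`, and only `lit a` itself gets past it.
-/
theorem fail_of_not_emb : ∀ (k N : ℕ) (ts : List Tok) (q : Word), q.length + ts.length ≤ k →
    q.length ≤ N → ts ≠ [] → ¬ Emb q (avoiding N ts) → Fail ts q := by
  intro k
  induction k with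
  | zero =>
    intro N ts q hk _ hts _
    rcases ts with _ | ⟨t, ts⟩
    · exact absurd rfl hts
    · simp at hk
  | succ k ih =>
    intro N ts q hk hN hts hq
    rcases q with _ | ⟨c, q⟩
    · simp at hq
    obtain ⟨M, rfl⟩ : ∃ M, N = M + 1 := ⟨N - 1, by simp at hN; omega⟩
    simp only [List.length_cons] at hk hN
    rcases ts with _ | ⟨t, ts⟩
    · exact absurd rfl hts
    simp only [List.length_cons] at hk
    rcases t with a | s
    · by_cases hc : c = lit a
      · subst hc
        refine .hit ?_
        rcases ts with _ | ⟨t, ts⟩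
        · exact .nil q
        · rw [avoiding, emb_lit_replicate, emb_cons_of_compat (by simp)] at hq
          exact ih (M + 1) _ q (by simp only [List.length_cons] at hk ⊢; omega) (by omega)
            (by simp) hq
      -- One copy in the block and one letter of `q` are used up together, so the bound on `N`
      -- persists; the later blocks also shrink to size `M`, which is harmless by monotonicity.
      · refine .stay hc (ih M _ q (by simp only [List.length_cons]; omega) (by omega) (by simp) ?_)
        intro h
        apply hq
        rcases ts with _ | ⟨t, ts⟩
        · simp only [avoiding, List.replicate_succ] at h ⊢
          rwa [emb_cons_of_compat (compat_not_of_ne_lit hc)]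
        · simp only [avoiding, List.replicate_succ, List.cons_append] at h ⊢
          rw [emb_cons_of_compat (compat_not_of_ne_lit hc)]
          exact emb_mono ((List.Sublist.refl _).append
            ((avoiding_sublist M (t :: ts)).cons_cons a)) h
    · rcases c.eq_star_or_lit with rfl | ⟨b, rfl⟩
      · refine .takeStar ?_
        rcases ts with _ | ⟨t, ts⟩
        · exact .nil q
        · rw [avoiding, emb_cons_of_compat (by simp)] at hq
          exact ih (M + 1) _ q (by simp only [List.length_cons] at hk ⊢; omega) (by omega)
            (by simp) hq
      · by_cases hb : b = s
        · subst hb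
          refine .takeLit ?_
          rcases ts with _ | ⟨t, ts⟩
          · exact .nil q
          · rw [avoiding, emb_cons_of_compat (by simp)] at hq
            exact ih (M + 1) _ q (by simp only [List.length_cons] at hk ⊢; omega) (by omega)
              (by simp) hq
        · obtain rfl : b = !s := by cases b <;> cases s <;> simp_all
          refine .skip ?_
          rcases ts with _ | ⟨t, ts⟩
          · exact .nil _
          · rw [avoiding, emb_cons_of_not_compat (by simp)] at hq
            exact ih (M + 1) _ _ (by simp only [List.length_cons] at hk ⊢; omega) (by simpa using hN)
              (by simp) hq

/-! ### What a failing word looks like -/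

/-- The last `*` of a run is directed like the letter that follows it. -/
def Good (ts : List Tok) : Prop :=
  ∀ (P Q : List Tok) (s a : Bool), ts = P ++ .st s :: .lit a :: Q → s = a

theorem Good.of_append {P ts : List Tok} (h : Good (P ++ ts)) : Good ts := by
  intro P' Q s a e
  exact h (P ++ P') Q s a (by rw [e, List.append_assoc])

theorem Good.tail {t : Tok} {ts : List Tok} (h : Good (t :: ts)) : Good ts :=
  Good.of_append (P := [t]) h

theorem letters_map_st (l : List Bool) :
    letters (l.map Tok.st) = List.replicate l.length Letter.star := by
  induction l with
  | nil => rfl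
  | cons s l ih => simp [ih, List.replicate_succ]

/-- A letter that is skipped by one `*` is read after a run of such `*`. -/
theorem Fail.exists_run {c : Bool} : ∀ {ts : List Tok} {q : Word}, Good ts →
    (∀ a Q, ts = .lit a :: Q → a ≠ c) → Fail ts (lit c :: q) →
    ∃ (l : List Bool) (B : List Tok), ts = l.map Tok.st ++ B ∧ Fail B q ∧
      ∀ i (hi : i < l.length), i + 1 < l.length → l[i] = !c
  | [], q, _, _, _ => ⟨[], [], rfl, .nil q, by simp⟩
  | .lit a :: ts, q, hg, hh, hf => by
    have hac := hh a ts rfl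
    generalize hp : lit c :: q = p at hf
    cases hf with
    | hit h => rw [List.cons.injEq] at hp; exact absurd (lit_injective hp.1).symm hac
    | stay hc h =>
      rw [List.cons.injEq] at hp
      obtain ⟨rfl, rfl⟩ := hp
      exact ⟨[], _, rfl, h, by simp⟩
  | .st s :: ts, q, hg, hh, hf => by
    generalize hp : lit c :: q = p at hf
    cases hf with
    | takeStar h => rw [List.cons.injEq] at hp; exact absurd hp.1 (lit_ne_star c)
    | takeLit h =>
      rw [List.cons.injEq] at hp
      obtain ⟨h1, rfl⟩ := hp
      exact ⟨[s], ts, rfl, h, by simp⟩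
    | skip h =>
      rw [List.cons.injEq] at hp
      obtain ⟨h1, rfl⟩ := hp
      have h1 := lit_injective h1
      subst h1
      -- `Good` matters here: a one-way letter right after the skipped `*` has direction `s`, so the
      -- pending letter `lit (!s)` cannot be matched with it and is an additional one-way letter.
      obtain ⟨l, B, rfl, hB, hl⟩ := Fail.exists_run hg.tail
        (by rintro a Q rfl; have := hg [] Q s a rfl; subst this; simp) h
      refine ⟨s :: l, B, rfl, hB, ?_⟩
      rintro (_ | i) hi hi'
      · simp
      · simpa using hl i (by simpa using hi) (by simpa using hi')

/-- Each step of the run matches equal letters, gives `q` an additional letter, or trades a `*` or a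
run of `*` for a one-way letter of `q`; hence the inequality. With equal counts only matches and
additional `*` occur, which gives the sublist. With an excess of one, the remainder after the
exceptional step has equal counts; staying in a block or replacing a single `*` would leave `q` no
shorter than `ts`, so that step trades a run of at least two. -/
theorem Fail.exists_split : ∀ (k : ℕ) (ts : List Tok) (q : Word), ts.length + q.length ≤ k →
    Good ts → Fail ts q →
    nonstars (letters ts) ≤ nonstars q ∧
    (nonstars q = nonstars (letters ts) → (letters ts).Sublist q) ∧
    (nonstars q = nonstars (letters ts) + 1 → q.length < ts.length →
      ∃ (A B : List Tok) (l : List Bool) (c : Bool) (A' B' : Word),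
        ts = A ++ l.map Tok.st ++ B ∧ q = A' ++ lit c :: B' ∧ 2 ≤ l.length ∧
        (letters A).Sublist A' ∧ (letters B).Sublist B' ∧
        ∀ i (hi : i < l.length), i + 1 < l.length → l[i] = !c) := by
  intro k
  induction k with
  | zero =>
    intro ts q hk _ _
    obtain rfl : ts = [] := List.length_eq_zero_iff.1 (by omega)
    simp
  | succ k ih =>
    intro ts q hk hg hf
    cases hf with
    | nil => simp
    | @hit a ts q h =>
      simp only [List.length_cons] at hk
      obtain ⟨h1, h2, h3⟩ := ih ts q (by omega) hg.tail h
      refine ⟨by simpa using h1, fun e => (h2 (by simpa using e)).cons_cons _, fun e hl => ?_⟩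
      obtain ⟨A, B, l, c, A', B', rfl, rfl, hl2, hA, hB, hi⟩ :=
        h3 (by simpa using e) (by simpa using hl)
      exact ⟨.lit a :: A, B, l, c, lit a :: A', B', by simp, by simp, hl2, hA.cons_cons _, hB, hi⟩
    | @stay a c ts q hc h =>
      obtain ⟨h1, h2, h3⟩ := ih _ q (by simp only [List.length_cons] at hk ⊢; omega) hg h
      rcases c.eq_star_or_lit with rfl | ⟨b, rfl⟩
      · refine ⟨by simpa using h1, fun e => (h2 (by simpa using e)).cons _, fun e hl => ?_⟩
        obtain ⟨A, B, l, c, A', B', e', rfl, hl2, hA, hB, hi⟩ :=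
          h3 (by simpa using e) (by simp only [List.length_cons] at hl ⊢; omega)
        exact ⟨A, B, l, c, .star :: A', B', e', by simp, hl2, hA.cons _, hB, hi⟩
      · refine ⟨by simp at h1 ⊢; omega, fun e => by simp at e h1; omega, fun e hl => ?_⟩
        have := (h2 (by simpa using e)).length_le
        simp at this hl
        omega
    | @takeStar s ts q h =>
      simp only [List.length_cons] at hk
      obtain ⟨h1, h2, h3⟩ := ih ts q (by omega) hg.tail h
      refine ⟨by simpa using h1, fun e => (h2 (by simpa using e)).cons_cons _, fun e hl => ?_⟩
      obtain ⟨A, B, l, c, A', B', rfl, rfl, hl2, hA, hB, hi⟩ :=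
        h3 (by simpa using e) (by simpa using hl)
      exact ⟨.st s :: A, B, l, c, .star :: A', B', by simp, by simp, hl2, hA.cons_cons _, hB, hi⟩
    | @takeLit s ts q h =>
      simp only [List.length_cons] at hk
      obtain ⟨h1, h2, h3⟩ := ih ts q (by omega) hg.tail h
      refine ⟨by simp; omega, fun e => by simp at e; omega, fun e hl => ?_⟩
      have := (h2 (by simpa using e)).length_le
      simp at this hl
      omega
    | @skip s ts q h =>
      obtain ⟨l, B, e0, hB, hl⟩ := Fail.exists_run (c := !s) hg (by simp) (Fail.skip h)
      have hlen : (Tok.st s :: ts).length = l.length + B.length := by rw [e0]; simp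
      have hns : nonstars (letters (Tok.st s :: ts)) = nonstars (letters B) := by
        rw [e0]; simp [letters_map_st]
      have hk' : B.length + q.length ≤ k := by
        rw [hlen] at hk; simp only [List.length_cons] at hk; omega
      obtain ⟨h1, h2, h3⟩ := ih B q hk' (Good.of_append (e0 ▸ hg)) hB
      rw [hns]
      refine ⟨by simp; omega, fun e => by simp at e; omega, fun e hlt => ?_⟩
      have h2 := h2 (by simpa using e)
      have := h2.length_le
      rw [hlen] at hlt
      simp at this hlt
      exact ⟨[], B, l, !s, [], q, by simpa using e0, by simp, by omega, by simp, h2, hl⟩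

theorem Fail.nonstars_lt {ts : List Tok} {q : Word} (hg : Good ts) (h : Fail ts q)
    (hl : q.length < ts.length) : nonstars (letters ts) < nonstars q := by
  obtain ⟨h1, h2, -⟩ := Fail.exists_split _ ts q le_rfl hg h
  rcases h1.lt_or_eq with h | h
  · exact h
  · have := (h2 h.symm).length_le
    simp at this
    omega

/-! ### Cyclic words as sequences of blocks -/

open List (replicate)

/-- A word all of whose runs of `*` follow a one-way letter, given by these letters and the lengths
of the runs. -/
def decode : List (Bool × ℕ) → Word
  | [] => []
  | b :: bs => lit b.1 :: (replicate b.2 Letter.star ++ decode bs)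

@[simp] theorem decode_nil : decode [] = [] := rfl

theorem decode_cons (a : Bool) (g : ℕ) (bs : List (Bool × ℕ)) :
    decode ((a, g) :: bs) = lit a :: (replicate g Letter.star ++ decode bs) := rfl

theorem decode_append (bs cs : List (Bool × ℕ)) : decode (bs ++ cs) = decode bs ++ decode cs := by
  induction bs with
  | nil => rfl
  | cons b bs ih => simp [decode, ih]

@[simp] theorem nonstars_decode (bs : List (Bool × ℕ)) : nonstars (decode bs) = bs.length := by
  induction bs with
  | nil => rfl
  | cons b bs ih => simp [decode, ih]

/-- Splitting of a word into a leading run of `*` and blocks. -/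
def encode : Word → ℕ × List (Bool × ℕ)
  | [] => (0, [])
  | .star :: q => ((encode q).1 + 1, (encode q).2)
  | .plus :: q => (0, (true, (encode q).1) :: (encode q).2)
  | .minus :: q => (0, (false, (encode q).1) :: (encode q).2)

@[simp] theorem encode_nil : encode [] = (0, []) := rfl
@[simp] theorem encode_star (q : Word) :
    encode (.star :: q) = ((encode q).1 + 1, (encode q).2) := rfl
@[simp] theorem encode_lit (a : Bool) (q : Word) :
    encode (lit a :: q) = (0, (a, (encode q).1) :: (encode q).2) := by
  cases a <;> rfl

@[simp] theorem encode_replicate_append (k : ℕ) (q : Word) :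
    encode (replicate k Letter.star ++ q) = ((encode q).1 + k, (encode q).2) := by
  induction k with
  | zero => simp
  | succ k ih => simp [List.replicate_succ, ih]; omega

@[simp] theorem encode_decode (bs : List (Bool × ℕ)) : encode (decode bs) = (0, bs) := by
  induction bs with
  | nil => rfl
  | cons b bs ih => simp [decode, ih]

theorem decode_injective : Function.Injective decode := by
  intro a b h
  have := congrArg encode h
  simpa using this

theorem decode_encode (q : Word) :
    replicate (encode q).1 Letter.star ++ decode (encode q).2 = q := by
  induction q with
  | nil => rfl
  | cons c q ih =>
    rcases c.eq_star_or_lit with rfl | ⟨a, rfl⟩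
    · simp [List.replicate_succ, ih]
    · simp [decode, ih]

theorem encode_append_decode (q : Word) (bs : List (Bool × ℕ)) :
    encode (q ++ decode bs) = ((encode q).1, (encode q).2 ++ bs) := by
  induction q with
  | nil => simp
  | cons c q ih =>
    rcases c.eq_star_or_lit with rfl | ⟨a, rfl⟩
    · simp [ih]
    · simp [ih]

theorem decode_concat_append (bs : List (Bool × ℕ)) (a : Bool) (g k : ℕ) :
    decode (bs ++ [(a, g)]) ++ replicate k Letter.star = decode (bs ++ [(a, g + k)]) := by
  simp [decode_append, decode]

theorem exists_decode_split {bs : List (Bool × ℕ)} : ∀ {X Y : Word} {a : Bool},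
    decode bs = X ++ lit a :: Y → ∃ b c, bs = b ++ c ∧ X = decode b ∧ lit a :: Y = decode c := by
  intro X Y a h
  have e : lit a :: Y = decode (encode (lit a :: Y)).2 := by
    conv_lhs => rw [← decode_encode (lit a :: Y)]
    simp
  rw [e] at h
  have h' := congrArg encode h
  rw [encode_decode, encode_append_decode, Prod.mk.injEq] at h'
  refine ⟨(encode X).2, _, h'.2, ?_, e⟩
  conv_lhs => rw [← decode_encode X]
  rw [← h'.1]; simp

/-- Both words begin with a one-way letter, so the rotation cuts at the boundary of a block. -/
theorem isRotated_of_decode {bs cs : List (Bool × ℕ)} (h : decode bs ~r decode cs) : bs ~r cs := by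
  obtain ⟨k, hk, h⟩ := List.isRotated_iff_mod.1 h
  rw [List.rotate_eq_drop_append_take hk] at h
  have h0 : decode bs = (decode bs).take k ++ (decode bs).drop k := (List.take_append_drop _ _).symm
  generalize (decode bs).take k = X at *
  generalize (decode bs).drop k = Y at *
  rcases Y with _ | ⟨c, Y⟩
  · simp only [List.append_nil, List.nil_append] at h h0
    rw [decode_injective (h0.trans h)]
  · rcases cs with _ | ⟨d, cs⟩
    · simp at h
    obtain rfl : c = lit d.1 := by simp [decode] at h; exact h.1
    obtain ⟨b, c, rfl, rfl, e⟩ := exists_decode_split h0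
    rw [e, ← decode_append] at h
    rw [← decode_injective h]
    exact List.isRotated_append

/-- If `p` arises from `q` by deleting some `*`, then every run of `*` in `p` is at most as long as
the corresponding one in `q`. -/
theorem encode_le_of_sublist {p q : Word} (h : p.Sublist q) :
    nonstars q ≤ nonstars p → (encode p).1 ≤ (encode q).1 ∧
      List.Forall₂ (fun x y => x.1 = y.1 ∧ x.2 ≤ y.2) (encode p).2 (encode q).2 := by
  induction h with
  | slnil => simp
  | @cons p q c h ih =>
    intro hn
    rcases c.eq_star_or_lit with rfl | ⟨a, rfl⟩
    · obtain ⟨h1, h2⟩ := ih (by simpa using hn)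
      exact ⟨by simp; omega, by simpa using h2⟩
    · have := nonstars_le_of_sublist h
      simp at hn
      omega
  | @cons_cons p q c h ih =>
    intro hn
    rcases c.eq_star_or_lit with rfl | ⟨a, rfl⟩
    · obtain ⟨h1, h2⟩ := ih (by simpa using hn)
      exact ⟨by simp; omega, by simpa using h2⟩
    · obtain ⟨h1, h2⟩ := ih (by simpa using hn)
      exact ⟨by simp, by simpa using ⟨h1, h2⟩⟩

/-! ### Comparing run lengths under rotation -/

/-- A cyclic sequence that is nowhere larger than one of its rotations except possibly at one
place, and smaller at the next place, has its maximum at this place. -/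
theorem le_of_le_rotation {m : ℕ} (hm : 0 < m) (γ : ℕ → ℕ) (κ α : ℕ)
    (hper : ∀ i, γ (i % m) = γ i)
    (hD : ∀ i, i % m ≠ α % m → γ i ≤ γ (i + κ)) (hlt : γ (α + 1) < γ (α + 1 + κ)) (i : ℕ) :
    γ i ≤ γ α := by
  by_contra! hi
  have hcongr : ∀ {x y : ℕ}, x ≡ y [MOD m] → γ x = γ y := by
    intro x y h
    rw [← hper x, ← hper y, h]
  -- If the orbit of `α + 1` under adding `κ` missed `α`, then `γ` would never decrease along it,
  -- yet the first step is strict and the orbit returns to its start. Consequently `-1`, and so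
  -- every residue, is a multiple of `κ`.
  obtain ⟨l, hl⟩ : ∃ l, (α + 1 + l * κ) % m = α % m := by
    by_contra! hne
    have hmono : ∀ l, γ (α + 1 + κ) ≤ γ (α + 1 + (l + 1) * κ) := by
      intro l
      induction l with
      | zero => simp
      | succ l ih =>
        refine ih.trans ((hD _ (hne (l + 1))).trans_eq ?_)
        congr 1; ring
    have h1 := hmono (m - 1)
    rw [Nat.sub_add_cancel hm] at h1
    have h2 : γ (α + 1 + m * κ) = γ (α + 1) := hcongr (by simp [Nat.ModEq])
    omega
  have hl : α + 1 + l * κ ≡ α [MOD m] := hl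
  -- Starting above `γ α`, the orbit of `i` never meets `α` and hence never decreases; but it covers
  -- all residues.
  have hT : ∀ k, γ α < γ (i + k * κ) := by
    intro k
    induction k with
    | zero => simpa using hi
    | succ k ih =>
      have hne : (i + k * κ) % m ≠ α % m := fun h => by
        rw [hcongr h] at ih; exact lt_irrefl _ ih
      have := hD _ hne
      have e : i + k * κ + κ = i + (k + 1) * κ := by ring
      rw [e] at this
      omega
  have key : ∀ j, j + j * (l * κ) ≡ 0 [MOD m] := by
    intro j
    have h0 : 1 + l * κ ≡ 0 [MOD m] := by
      apply Nat.ModEq.add_left_cancel' α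
      simpa [add_assoc] using hl
    simpa [mul_add] using h0.mul_left j
  -- The term `(m - 1) * α` stands for `-α` modulo `m`.
  have h3 : i + ((i + (m - 1) * α) * l) * κ ≡ α [MOD m] := by
    apply Nat.ModEq.add_right_cancel' ((m - 1) * α)
    have h4 := key (i + (m - 1) * α)
    have h5 : α + (m - 1) * α ≡ 0 [MOD m] := by
      have : α + (m - 1) * α = m * α := by
        obtain ⟨m', rfl⟩ : ∃ m', m = m' + 1 := ⟨m - 1, by omega⟩
        simp; ring
      rw [this]; simp [Nat.ModEq]
    refine Nat.ModEq.trans ?_ h5.symm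
    convert h4 using 1
    ring
  have := hT ((i + (m - 1) * α) * l)
  rw [hcongr h3] at this
  exact lt_irrefl _ this

/-- As `R` contains a one-way letter, the run can be rotated behind the last one, where it is part
of a single block. -/
theorem exists_large_block {bs : List (Bool × ℕ)} (hbs : bs ≠ []) {t : ℕ} {R : Word}
    (h : decode bs ~r replicate t Letter.star ++ R) : ∃ b ∈ bs, t ≤ b.2 := by
  have hns := h.perm.countP_eq (· ≠ .star)
  change nonstars _ = nonstars _ at hns
  rw [← decode_encode R] at h hns
  rcases List.eq_nil_or_concat' (encode R).2 with e | ⟨cs, ⟨a, g⟩, e⟩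
  · rw [e] at hns
    simp at hns
    exact absurd hns hbs
  · rw [e, ← List.append_assoc] at h
    have h2 := h.trans List.isRotated_append
    rw [← List.replicate_add, decode_concat_append] at h2
    have h3 := isRotated_of_decode h2
    refine ⟨(a, g + (t + (encode R).1)), h3.mem_iff.2 (by simp), by simp; omega⟩

/-- In blocks, the second word dominates the first one everywhere except possibly at the block of
`a`, and strictly at the next block, that of `e'`. Being a rotation of it, it forces the block of
`a`, of size `i + l`, to be the largest; this contradicts the run of length `t`. -/
theorem not_isRotated_of_shift {A B A' B' R : Word} {i l t : ℕ} {a e e' : Bool}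
    (hA : (A ++ lit a :: replicate i Letter.star).Sublist A')
    (hB : (Letter.star :: B).Sublist B')
    (hn : nonstars A' + nonstars B' ≤ nonstars A + nonstars B + 1)
    (ht : i + l < t)
    (hrun : A ++ lit a :: replicate (i + l) Letter.star ++ lit e' :: B ++ [.star, .star] ~r
      replicate t Letter.star ++ R)
    (h : A ++ lit a :: replicate (i + l) Letter.star ++ lit e' :: B ++ [.star, .star] ~r
      A' ++ lit e :: B' ++ [.star, .star]) : False := by
  set X : Word := B ++ [.star, .star] ++ A
  have hXY : (Letter.star :: (X ++ decode [(a, i)])).Sublist (B' ++ [.star, .star] ++ A') := by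
    have := (hB.append (List.Sublist.refl [Letter.star, .star])).append hA
    simpa [X, decode] using this
  obtain ⟨h1, h2⟩ := encode_le_of_sublist hXY (by simp [X, decode]; omega)
  simp only [encode_star, encode_append_decode] at h1 h2
  set bs := (encode X).2
  set Y : Word := B' ++ [.star, .star] ++ A'
  have hV : A ++ lit a :: replicate (i + l) Letter.star ++ lit e' :: B ++ [.star, .star] ~r
      decode ((e', (encode X).1) :: bs ++ [(a, i + l)]) := by
    have e1 : decode ((e', (encode X).1) :: bs ++ [(a, i + l)]) =
        (lit e' :: B ++ [.star, .star]) ++ (A ++ lit a :: replicate (i + l) Letter.star) := by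
      rw [decode_append]
      simp only [decode, bs, decode_encode]
      simp [X]
    rw [e1, List.append_assoc]
    exact List.isRotated_append
  have hU : A' ++ lit e :: B' ++ [.star, .star] ~r decode ((e, (encode Y).1) :: (encode Y).2) := by
    have e1 : decode ((e, (encode Y).1) :: (encode Y).2) =
        (lit e :: B' ++ [.star, .star]) ++ A' := by
      simp only [decode, decode_encode]
      simp [Y]
    rw [e1, List.append_assoc]
    exact List.isRotated_append
  have hr := isRotated_of_decode ((hV.symm.trans h).trans hU)
  obtain ⟨b, hb, htb⟩ := exists_large_block (by simp) (hV.symm.trans hrun)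
  have hlenY : (encode Y).2.length = bs.length + 1 := by
    rw [← h2.length_eq]; simp
  obtain ⟨κ, hκ⟩ := hr
  set V : List (Bool × ℕ) := (e', (encode X).1) :: bs ++ [(a, i + l)]
  have hVlen : V.length = bs.length + 2 := by simp [V]
  set m := bs.length + 2
  have hpos : ∀ j, j % m < V.length := fun j => by rw [hVlen]; exact Nat.mod_lt _ (by omega)
  let γ : ℕ → ℕ := fun j => (V[j % m]'(hpos j)).2
  have hγκ : ∀ j (hj : j < m), γ (j + κ) =
      (((e, (encode Y).1) :: (encode Y).2)[j]'(by simp [hlenY]; omega)).2 := by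
    intro j hj
    have : ((e, (encode Y).1) :: (encode Y).2)[j]'(by simp [hlenY]; omega) =
        (V.rotate κ)[j]'(by simp [hVlen]; omega) := by simp [hκ]
    rw [this, List.getElem_rotate]
    simp [γ, hVlen]
  have hper : ∀ j, γ (j % m) = γ j := fun j => by simp [γ]
  have hperκ : ∀ j, γ (j % m + κ) = γ (j + κ) := fun j => by
    rw [← hper (j % m + κ), ← hper (j + κ)]; simp
  obtain ⟨j, hj, rfl⟩ := List.mem_iff_getElem.1 hb
  -- The block of `a` is listed last, at `m - 1`; cyclically the next place is `0`, the block of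
  -- `e'`.
  have hmax := le_of_le_rotation (m := m) (by omega) γ κ (m - 1) hper ?_ ?_ j
  · have e1 : γ j = V[j].2 := by simp [γ, Nat.mod_eq_of_lt (hVlen ▸ hj)]
    have e2 : γ (m - 1) = i + l := by
      have : (m - 1) % m = bs.length + 1 := by
        rw [Nat.mod_eq_of_lt (by omega)]; omega
      simp [γ, this, V]
    omega
  · intro j hj
    rw [← hperκ, ← hper j]
    have hjm : j % m < m := Nat.mod_lt _ (by omega)
    generalize j % m = y at hj hjm
    rw [Nat.mod_eq_of_lt (by omega : m - 1 < m)] at hj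
    rw [hγκ y hjm]
    rcases y with _ | y
    · simp [γ, V]; omega
    · have hy : y < bs.length := by omega
      have e1 : γ (y + 1) = (bs[y]'hy).2 := by
        simp [γ, V, Nat.mod_eq_of_lt hjm, List.getElem_append_left hy]
      rw [e1]
      have := (List.forall₂_iff_get.1 h2).2 y (by simp; omega) (by omega)
      simpa [List.getElem_append_left hy] using this.2
  · have e0 : m - 1 + 1 = m := by omega
    rw [e0, ← hperκ, ← hper m]
    simp only [Nat.mod_self]
    rw [hγκ 0 (by omega)]
    simp [γ, V]
    omega

/-! ### Reading a cyclic word in both directions -/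

/-- The word read along the same arcs in the opposite direction. -/
def inv (q : Word) : Word := (q.map Letter.flip).reverse

@[simp] theorem inv_nil : inv [] = [] := rfl

@[simp] theorem inv_append (p q : Word) : inv (p ++ q) = inv q ++ inv p := by simp [inv]

theorem inv_cons (c : Letter) (q : Word) : inv (c :: q) = inv q ++ [c.flip] := by simp [inv]

@[simp] theorem flip_flip (c : Letter) : c.flip.flip = c := by cases c <;> rfl

@[simp] theorem flip_star : Letter.star.flip = .star := rfl

@[simp] theorem flip_lit (a : Bool) : (lit a).flip = lit (!a) := by cases a <;> rfl

@[simp] theorem inv_inv (q : Word) : inv (inv q) = q := by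
  simp [inv, List.map_reverse, Function.comp_def]

@[simp] theorem inv_replicate (k : ℕ) :
    inv (replicate k Letter.star) = replicate k Letter.star := by simp [inv]

@[simp] theorem length_inv (q : Word) : (inv q).length = q.length := by simp [inv]

@[simp] theorem nonstars_inv (q : Word) : nonstars (inv q) = nonstars q := by
  induction q with
  | nil => rfl
  | cons c q ih =>
    rcases c.eq_star_or_lit with rfl | ⟨a, rfl⟩ <;> rw [inv_cons] <;> simp [ih]

theorem isRotated_inv {p q : Word} (h : p ~r q) : inv p ~r inv q := (h.map _).reverse

/-- Reversal attaches each run to the one-way letter on its other side; the letter `lit a` put in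
front supplies the neighbour missing at the end. -/
theorem lit_cons_inv_decode (bs : List (Bool × ℕ)) (a : Bool) : ∃ (cs : List (Bool × ℕ)) (b : Bool),
    lit a :: inv (decode bs) = decode cs ++ [lit b] ∧ (cs.map Prod.snd).Perm (bs.map Prod.snd) := by
  induction bs with
  | nil => exact ⟨[], a, rfl, .refl _⟩
  | cons d bs ih =>
    obtain ⟨cs, b, h, hp⟩ := ih
    refine ⟨cs ++ [(b, d.2)], !d.1, ?_, ?_⟩
    · rw [decode, inv_cons, inv_append, inv_replicate, List.append_assoc, ← List.cons_append, h]
      simp [decode_append, decode]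
    · simpa using (List.perm_append_comm.trans (hp.cons d.2))

theorem inv_decode {bs : List (Bool × ℕ)} (hbs : bs ≠ []) : ∃ cs : List (Bool × ℕ),
    inv (decode bs) ~r decode cs ∧ (cs.map Prod.snd).Perm (bs.map Prod.snd) := by
  rcases bs with _ | ⟨d, bs⟩
  · exact absurd rfl hbs
  obtain ⟨cs, b, h, hp⟩ := lit_cons_inv_decode bs (!d.1)
  refine ⟨cs ++ [(b, d.2)], ?_, ?_⟩
  · have e1 : decode (cs ++ [(b, d.2)]) =
        [lit !d.1] ++ (inv (decode bs) ++ replicate d.2 Letter.star) := by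
      rw [decode_append, ← List.append_assoc]
      simp only [List.singleton_append, h]
      simp [decode]
    rw [e1, decode, inv_cons, inv_append, inv_replicate, flip_lit]
    exact List.isRotated_append
  · simpa using (List.perm_append_comm.trans (hp.cons d.2))

/-- The two ways to read a cyclic word. -/
def reading (W : Word) (τ : Bool) : Word := if τ then W else inv W

theorem length_reading (W : Word) (τ : Bool) : (reading W τ).length = W.length := by
  cases τ <;> simp [reading]

theorem nonstars_reading (W : Word) (τ : Bool) : nonstars (reading W τ) = nonstars W := by
  cases τ <;> simp [reading]

theorem nonstars_eq_of_isRotated {p q : Word} (h : p ~r q) : nonstars p = nonstars q :=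
  h.perm.countP_eq _

theorem reading_run {P Q : Word} {t : ℕ} (τ : Bool) :
    ∃ R, reading (P ++ replicate t Letter.star ++ Q) τ ~r replicate t Letter.star ++ R := by
  cases τ
  · refine ⟨inv P ++ inv Q, ?_⟩
    simp only [reading, inv_append, inv_replicate, Bool.false_eq_true, if_false]
    refine List.isRotated_append.trans ?_
    simp [List.IsRotated.refl]
  · refine ⟨Q ++ P, ?_⟩
    simp only [reading, if_true]
    rw [List.append_assoc]
    refine List.isRotated_append.trans ?_
    simp [List.IsRotated.refl]

/-- The multiset of run lengths does not depend on the reading. The move turns the lengths `t`, `u`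
into `t - 2 - p`, `u + 2 + p` and keeps the others; comparing sums of squares gives `(p + 2) * (u -
(t - 2 - p)) = 0`. -/
theorem leading_run_position {t u p : ℕ} {b b' e τ : Bool} {bs : List (Bool × ℕ)} (hp : p + 2 ≤ t)
    (h : replicate p Letter.star ++ lit e :: (replicate (t - 2 - p) Letter.star ++
      decode (bs ++ [(b', u)])) ++ [.star, .star] ~r
      reading (replicate t Letter.star ++ decode (bs ++ [(b', u)]) ++ [lit b]) τ) :
    t = p + 2 + u := by
  have hV : replicate p Letter.star ++ lit e :: (replicate (t - 2 - p) Letter.star ++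
      decode (bs ++ [(b', u)])) ++ [.star, .star] ~r
      decode ((e, t - 2 - p) :: bs ++ [(b', u + (2 + p))]) := by
    rw [List.append_assoc]
    refine List.isRotated_append.trans ?_
    rw [List.cons_append (bs := [(b', u + (2 + p))]), decode_cons, ← decode_concat_append,
      List.replicate_add]
    simp [List.replicate, List.IsRotated.refl]
  have hW : replicate t Letter.star ++ decode (bs ++ [(b', u)]) ++ [lit b] ~r
      decode ((b, t) :: (bs ++ [(b', u)])) := by
    refine List.isRotated_append.trans ?_
    simp [decode_cons, List.IsRotated.refl]
  obtain ⟨cs, hcs, hperm⟩ : ∃ cs, reading (replicate t Letter.star ++ decode (bs ++ [(b', u)]) ++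
      [lit b]) τ ~r decode cs ∧
      (cs.map Prod.snd).Perm (((b, t) :: (bs ++ [(b', u)])).map Prod.snd) := by
    cases τ
    · obtain ⟨cs, h1, h2⟩ := inv_decode (bs := (b, t) :: (bs ++ [(b', u)])) (by simp)
      exact ⟨cs, (isRotated_inv hW).trans h1, h2⟩
    · exact ⟨_, hW, .refl _⟩
  have h1 := (isRotated_of_decode ((hV.symm.trans h).trans hcs)).perm.map Prod.snd
  have h2 := ((h1.trans hperm).map (fun g : ℕ => (g : ℤ) ^ 2)).sum_eq
  simp only [List.cons_append, List.map_cons, List.map_append, List.sum_cons, List.sum_append,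
    List.map_nil, List.sum_nil] at h2
  obtain ⟨k, rfl⟩ : ∃ k, t = p + 2 + k := ⟨t - (p + 2), by omega⟩
  have e1 : p + 2 + k - 2 - p = k := by omega
  rw [e1] at h2
  push_cast at h2
  have h3 : ((p : ℤ) + 2) * (u - k) = 0 := by linarith
  rcases mul_eq_zero.1 h3 with h3 | h3 <;> omega

/-! ### Choice of the directions and the resulting failing word -/

open Classical in
/-- Directions that are prescribed on `J` and alternate within each run, except right after an
element of `J` that is not the last one in its run. -/
theorem exists_alternating (star J : ℕ → Prop) (c : ℕ → Bool) : ∃ s : ℕ → Bool,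
    (∀ p, J p → star p → s p = c p) ∧
    ∀ p, star p → star (p + 1) → s (p + 1) = (!s p) ∨
      (J p ∧ ∃ p', p < p' ∧ J p' ∧ ∀ y, p ≤ y → y ≤ p' → star y) := by
  let E : ℕ → ℕ → Prop := fun p k => J (p + k) ∧ ∀ y ≤ k, star (p + y)
  let val : (p : ℕ) → (∃ k, E p k) → Bool := fun p h => xor (c (p + Nat.find h)) (Nat.find h).bodd
  -- If an element of `J` lies ahead in the run, the directions alternate backwards from the nearest
  -- one; otherwise they alternate forwards from the previous position.
  let s : ℕ → Bool := fun p => Nat.rec (if h : ∃ k, E 0 k then val 0 h else true)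
    (fun p sp => if h : ∃ k, E (p + 1) k then val (p + 1) h else !sp) p
  have s1 : ∀ p (h : ∃ k, E p k), s p = val p h := by
    rintro (_ | p) h
    · exact dif_pos h
    · exact dif_pos h
  have s2 : ∀ p, (¬ ∃ k, E (p + 1) k) → s (p + 1) = !s p := fun p h => dif_neg h
  refine ⟨s, ?_, ?_⟩
  · intro p hJ hs
    have h0 : E p 0 := ⟨hJ, fun y hy => by obtain rfl : y = 0 := by omega
                                           exact hs⟩
    have h : ∃ k, E p k := ⟨0, h0⟩
    rw [s1 p h]
    have : Nat.find h = 0 := (Nat.find_eq_zero h).2 h0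
    simp [val, this]
  · intro p hp hp'
    by_cases h : ∃ k, E (p + 1) k
    · by_cases hJ : J p
      · right
        obtain ⟨k, hk, hk'⟩ := h
        refine ⟨hJ, p + 1 + k, by omega, hk, fun y h1 h2 => ?_⟩
        rcases h1.eq_or_lt with rfl | h1
        · exact hp
        · have := hk' (y - (p + 1)) (by omega)
          rwa [show p + 1 + (y - (p + 1)) = y by omega] at this
      · left
        have hE : ∀ k, E p (k + 1) ↔ E (p + 1) k := by
          intro k
          simp only [E]
          rw [show p + (k + 1) = p + 1 + k by ring]
          refine and_congr_right fun _ => ⟨fun h y hy => ?_, fun h y hy => ?_⟩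
          · have := h (y + 1) (by omega)
            rwa [show p + (y + 1) = p + 1 + y by ring] at this
          · rcases y with _ | y
            · exact hp
            · have := h y (by omega)
              rwa [show p + (y + 1) = p + 1 + y by ring]
        have h0 : ∃ k, E p k := by
          obtain ⟨k, hk⟩ := h
          exact ⟨k + 1, (hE k).2 hk⟩
        have hfind : Nat.find h0 = Nat.find h + 1 := by
          rw [Nat.find_eq_iff]
          refine ⟨(hE _).2 (Nat.find_spec h), ?_⟩
          rintro (_ | k) hk
          · exact fun hE0 => hJ hE0.1
          · rw [hE]; exact Nat.find_min h (by omega)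
        rw [s1 _ h, s1 _ h0]
        simp only [val, hfind, Nat.bodd_succ]
        rw [show p + (Nat.find h + 1) = p + 1 + Nat.find h by ring]
        cases c (p + 1 + Nat.find h) <;> cases (Nat.find h).bodd <;> rfl
    · exact Or.inl (s2 p h)

/-- The directions `s` can be imposed only where another `*` follows; the last `*` of a run before a
one-way letter is dictated by `Good`. -/
theorem exists_tokens (r : Word) : ∀ s : ℕ → Bool, ∃ ts : List Tok, letters ts = r ∧ Good ts ∧
    ∀ p v, ts[p]? = some (.st v) → r[p + 1]? = some .star → v = s p := by
  induction r with
  | nil => exact fun s => ⟨[], rfl, by intro P Q s a h; simp at h, by simp⟩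
  | cons c r ih =>
    intro s
    obtain ⟨ts, h1, h2, h3⟩ := ih (fun i => s (i + 1))
    rcases c.eq_star_or_lit with rfl | ⟨a, rfl⟩
    · obtain ⟨v, hv, hv'⟩ : ∃ v, (∀ a Q, ts = .lit a :: Q → v = a) ∧
          (r[0]? = some .star → v = s 0) := by
        rcases ts with _ | ⟨_ | _, ts⟩
        · exact ⟨s 0, by simp, fun _ => rfl⟩
        · rename_i a
          refine ⟨a, by simp, ?_⟩
          rw [← h1]
          simp [lit_ne_star]
        · exact ⟨s 0, by simp, fun _ => rfl⟩
      refine ⟨.st v :: ts, by simp [h1], ?_, ?_⟩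
      · rintro (_ | ⟨t, P⟩) Q s a e
        · simp only [List.nil_append, List.cons.injEq, Tok.st.injEq] at e
          rw [← e.1]; exact hv a Q e.2
        · simp only [List.cons_append, List.cons.injEq] at e
          exact h2 P Q s a e.2
      · rintro (_ | p) v' e e'
        · simp at e e'
          rw [← e]; exact hv' (by simpa using e')
        · exact h3 p v' (by simpa using e) (by simpa using e')
    · refine ⟨.lit a :: ts, by simp [h1], ?_, ?_⟩
      · rintro (_ | ⟨t, P⟩) Q s a e
        · simp at e
        · simp only [List.cons_append, List.cons.injEq] at e
          exact h2 P Q s a e.2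
      · rintro (_ | p) v' e e'
        · simp at e
        · exact h3 p v' (by simpa using e) (by simpa using e')

/-- The failing `q` is shorter than `r`, hence has more one-way letters. Since `q` with two letters
and `r` with one letter added have equally many, `x` is one-way and both letters added to `q` are
`*`. -/
theorem exists_fail {r : Word} {x : Letter} (hr : r ≠ [])
    (H : ∀ w, (∀ q y z, (∃ τ, q ++ [y, z] ~r reading (r ++ [x]) τ) → Emb q w) → Emb r w)
    {ts : List Tok} (hts : letters ts = r) (hg : Good ts) :
    ∃ q τ, x ≠ .star ∧ q ++ [.star, .star] ~r reading (r ++ [x]) τ ∧ Fail ts q ∧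
      nonstars q = nonstars r + 1 ∧ q.length + 1 = r.length := by
  have hts0 : ts ≠ [] := by rintro rfl; exact hr hts.symm
  have h1 := mt (H (avoiding r.length ts)) (hts ▸ not_emb_avoiding _ ts hts0)
  push Not at h1
  obtain ⟨q, y, z, ⟨τ, hq⟩, hemb⟩ := h1
  have hlen := hq.perm.length_eq
  rw [length_reading] at hlen
  simp at hlen
  have hf := fail_of_not_emb _ r.length ts q le_rfl (by omega) hts0 hemb
  have hl : ts.length = r.length := by rw [← hts]; simp
  have hlt := hf.nonstars_lt hg (by omega)
  rw [hts] at hlt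
  have hn := nonstars_eq_of_isRotated hq
  rw [nonstars_reading] at hn
  refine ⟨q, τ, ?_⟩
  rcases x.eq_star_or_lit with rfl | ⟨b, rfl⟩
  · simp at hn; omega
  rcases y.eq_star_or_lit with rfl | ⟨y, rfl⟩ <;> rcases z.eq_star_or_lit with rfl | ⟨z, rfl⟩ <;>
    simp at hn <;> try omega
  exact ⟨lit_ne_star b, hq, hf, by omega, by omega⟩

theorem count_plus_eq_of_sublist {p q : Word} (h : p.Sublist q) :
    nonstars q ≤ nonstars p → p.count .plus = q.count .plus := by
  induction h with
  | slnil => simp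
  | @cons p q c h ih =>
    intro hn
    rcases c.eq_star_or_lit with rfl | ⟨a, rfl⟩
    · simpa using ih (by simpa using hn)
    · have := nonstars_le_of_sublist h
      simp at hn
      omega
  | @cons_cons p q c h ih =>
    intro hn
    rw [List.count_cons, List.count_cons]
    rcases c.eq_star_or_lit with rfl | ⟨a, rfl⟩
    · rw [ih (by simpa using hn)]
    · rw [ih (by simpa using hn)]

theorem eq_of_count_plus {a b : Bool}
    (h : (if lit a = .plus then 1 else 0) = (if lit b = .plus then 1 else 0)) : a = b := by
  cases a <;> cases b <;> simp [lit] at h <;> rfl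

theorem eq_replicate_or_exists_last (A : Word) : (∃ k, A = replicate k Letter.star) ∨
    ∃ A₀ a i, A = A₀ ++ lit a :: replicate i Letter.star := by
  have h := decode_encode A
  rcases List.eq_nil_or_concat' (encode A).2 with e | ⟨cs, ⟨a, g⟩, e⟩
  · left
    rw [e] at h
    exact ⟨_, by simpa using h.symm⟩
  · right
    rw [e, decode_append] at h
    generalize (encode A).1 = y at h
    exact ⟨replicate y Letter.star ++ decode cs, a, g, by rw [← h]; simp [decode]⟩

/-- Within one reading the number of `+` is invariant, and additional `*` do not affect it, so it
identifies the inserted letter. -/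
theorem letter_eq_of_isRotated {A B A' B' C D L : Word} {e e' : Bool} {a : ℕ}
    (hA : A.Sublist A') (hB : B.Sublist B')
    (hn : nonstars A' + nonstars B' ≤ nonstars A + nonstars B)
    (hr : A ++ replicate a Letter.star ++ B = C ++ [.star, .star] ++ D)
    (h : A' ++ lit e :: B' ++ [.star, .star] ~r L)
    (h' : C ++ lit e' :: D ++ [.star, .star] ~r L) : e = e' := by
  have hA1 := nonstars_le_of_sublist hA
  have hB1 := nonstars_le_of_sublist hB
  have cA := count_plus_eq_of_sublist hA (by omega)
  have cB := count_plus_eq_of_sublist hB (by omega)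
  have cr := congrArg (List.count Letter.plus) hr
  have c := (h.trans h'.symm).perm.count_eq Letter.plus
  simp only [List.count_append, List.count_cons, List.count_nil, List.count_replicate,
    beq_iff_eq, reduceCtorEq, if_false] at c cr
  apply eq_of_count_plus
  omega

/-! ### The combinatorial core -/

theorem exists_double_star {r : Word} {x : Letter} (hr : 2 ≤ r.length)
    (H : ∀ w, (∀ q y z, (∃ τ, q ++ [y, z] ~r reading (r ++ [x]) τ) → Emb q w) → Emb r w) :
    ∃ A B b, x = lit b ∧ r = A ++ [.star, .star] ++ B ∧
      ∀ e, ∃ τ, A ++ lit e :: B ++ [.star, .star] ~r reading (r ++ [x]) τ := by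
  have hr0 : r ≠ [] := by rintro rfl; simp at hr
  by_contra hno
  obtain ⟨b, rfl⟩ : ∃ b, x = lit b := by
    obtain ⟨ts, h1, h2, -⟩ := exists_tokens r (fun _ => true)
    obtain ⟨q, τ, hx, -⟩ := exists_fail hr0 H h1 h2
    exact x.eq_star_or_lit.resolve_left hx
  set W := r ++ [lit b] with hW
  have hboth : ∀ A B e, r = A ++ [.star, .star] ++ B →
      (∃ τ, A ++ lit e :: B ++ [.star, .star] ~r reading W τ) →
      (∃ τ, A ++ lit (!e) :: B ++ [.star, .star] ~r reading W τ) → False := by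
    intro A B e h0 h1 h2
    refine hno ⟨A, B, b, rfl, h0, fun e' => ?_⟩
    by_cases he : e' = e
    · rwa [he]
    · obtain rfl : e' = !e := by cases e <;> cases e' <;> simp_all
      exact h2
  -- `J` collects the positions of a `**` in `r` that works for at least one letter; by assumption
  -- none works for both, and `c` records the letter that does. Directing the `*` at such a position
  -- like `c` makes a failure there yield the other letter.
  let J : ℕ → Prop := fun p => ∃ A B e, r = A ++ [.star, .star] ++ B ∧ A.length = p ∧
    ∃ τ, A ++ lit e :: B ++ [.star, .star] ~r reading W τ
  have hc : ∀ p, ∃ e, J p → ∃ A B, r = A ++ [.star, .star] ++ B ∧ A.length = p ∧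
      ∃ τ, A ++ lit e :: B ++ [.star, .star] ~r reading W τ := by
    intro p
    by_cases h : J p
    · obtain ⟨A, B, e, h⟩ := h
      exact ⟨e, fun _ => ⟨A, B, h⟩⟩
    · exact ⟨true, fun h' => absurd h' h⟩
  choose c hc using hc
  have hcJ : ∀ A B, r = A ++ [.star, .star] ++ B → J A.length →
      ∃ τ, A ++ lit (c A.length) :: B ++ [.star, .star] ~r reading W τ := by
    intro A B h0 hJ
    obtain ⟨A₁, B₁, h1, h2, h3⟩ := hc _ hJ
    rw [h0, List.append_assoc, List.append_assoc] at h1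
    obtain ⟨rfl, h4⟩ := List.append_inj h1 h2.symm
    simp only [List.cons_append, List.nil_append, List.cons.injEq, true_and] at h4
    rwa [h4]
  obtain ⟨s, hsJ, hs⟩ := exists_alternating (fun p => r[p]? = some .star) J c
  obtain ⟨ts, hts, hg, htv⟩ := exists_tokens r s
  obtain ⟨q, τ, -, hq, hf, hqn, hql⟩ := exists_fail hr0 H hts hg
  have htl : ts.length = r.length := by rw [← hts]; simp
  obtain ⟨tA, tB, l, e, A', B', rfl, rfl, hl2, hA, hB, hli⟩ :=
    (Fail.exists_split _ ts q le_rfl hg hf).2.2 (by rw [hts, hqn]) (by omega)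
  set A := letters tA
  set B := letters tB
  have hrAB : r = A ++ replicate l.length Letter.star ++ B := by
    rw [← hts]; simp [letters_map_st, A, B]
  have hn : nonstars A' + nonstars B' = nonstars A + nonstars B := by
    rw [hrAB] at hqn; simp at hqn; omega
  have hv : ∀ i (hi : i < l.length), r[A.length + i + 1]? = some .star →
      l[i] = s (A.length + i) := by
    intro i hi h
    refine htv _ _ ?_ h
    rw [List.append_assoc, List.getElem?_append_right (by simp [A])]
    simp [A, List.getElem?_append_left, hi]
  have hql' : A'.length + B'.length + 2 = A.length + l.length + B.length := by
    rw [hrAB] at hql; simp at hql; omega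
  rw [← hW] at hq
  clear_value A B W
  clear htl hf hts hg htv H hql hqn
  have hstar : ∀ i < l.length, r[A.length + i]? = some .star := by
    intro i hi
    rw [hrAB, List.append_assoc, List.getElem?_append_right (by simp)]
    simp [List.getElem?_append_left, hi]
  have hs0 : s A.length = !e := by
    have h1 := hv 0 (by omega) (hstar 1 (by omega))
    rw [hli 0 (by omega) (by omega)] at h1
    exact h1.symm
  -- For a run of exactly two, the lengths leave no room for additional `*`, so `q = A e B`, while
  -- the prescribed direction `!e` says that the opposite letter works as well.
  rcases hl2.eq_or_lt with hl2 | hl3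
  · rw [← hl2] at hrAB
    have hA1 := hA.length_le
    have hB1 := hB.length_le
    obtain rfl := hA.eq_of_length (by omega)
    obtain rfl := hB.eq_of_length (by omega)
    have hJ : J A.length := ⟨A, B, e, hrAB, rfl, τ, hq⟩
    have h1 := hsJ _ hJ (hstar 0 (by omega))
    have h2 := hcJ A B hrAB hJ
    rw [← h1, hs0] at h2
    exact hboth A B e hrAB ⟨τ, hq⟩ h2
  · have hs1 : s (A.length + 1) = !e := by
      have h1 := hv 1 (by omega) (hstar 2 (by omega))
      rw [hli 1 (by omega) (by omega)] at h1
      exact h1.symm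
    -- In a longer run the first two directions agree. This exception to alternation occurs only at
    -- an element of `J` followed by another one, `p'`, in the same run.
    obtain ⟨hJ, p', hpp, hJ', hrun⟩ := (hs A.length (hstar 0 (by omega))
      (hstar 1 (by omega))).resolve_left (by rw [hs0, hs1]; simp)
    obtain ⟨A₂, B₂, hr2, hlA₂, τ₂, hτ₂⟩ := hc p' hJ'
    obtain ⟨k, hk, hA₂⟩ : ∃ k, 0 < k ∧ A₂ = A ++ replicate k Letter.star := by
      refine ⟨p' - A.length, by omega, ?_⟩
      have h1 : A₂ = r.take p' := by rw [hr2, List.append_assoc, ← hlA₂]; simp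
      have h2 : A = r.take A.length := by rw [hrAB, List.append_assoc]; simp
      have hple : p' ≤ r.length := by rw [hr2]; simp; omega
      apply List.ext_getElem?
      intro i
      rcases lt_or_ge i A.length with hi | hi
      · rw [List.getElem?_append_left hi, h1, List.getElem?_take_of_lt (by omega), h2,
          List.getElem?_take_of_lt hi]
      · rw [List.getElem?_append_right hi]
        rcases lt_or_ge i p' with hi' | hi'
        · rw [h1, List.getElem?_take_of_lt hi', hrun i hi hi'.le, List.getElem?_replicate_of_lt]
          omega
        · rw [List.getElem?_eq_none (by omega), List.getElem?_eq_none (by simp; omega)]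
    have hp' : p' = A.length + k := by rw [← hlA₂, hA₂]; simp
    clear hlA₂
    subst hA₂
    have hr1 : r = A ++ [.star, .star] ++ (replicate k Letter.star ++ B₂) := by
      rw [hr2]
      have : replicate k Letter.star ++ [.star, .star] =
          [.star, .star] ++ replicate k Letter.star := by
        rw [show [Letter.star, .star] = replicate 2 Letter.star from rfl, ← List.replicate_add,
          ← List.replicate_add, add_comm]
      simp only [List.append_assoc] at this ⊢
      rw [← List.append_assoc (replicate k _), this]
      simp
    have hcp : c A.length = !e := by rw [← hsJ _ hJ (hstar 0 (by omega)), hs0]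
    obtain ⟨τ₁, hτ₁⟩ := hcJ A _ hr1 hJ
    rw [hcp] at hτ₁
    have hcp' : c p' = s p' := (hsJ _ hJ' (hrun _ (by omega) le_rfl)).symm
    -- If the run starts `r`, its length determines the position in `J`, so `A.length` and `p'`
    -- cannot both occur; a word `r` consisting of `*` alone admits both letters directly, through
    -- the two readings.
    rcases eq_replicate_or_exists_last A with ⟨p, hAp⟩ | ⟨A₀, a, i, hAi⟩
    · rcases List.eq_nil_or_concat' (encode B₂).2 with e0 | ⟨bs, ⟨b', u⟩, e0⟩
      · have hB₂ := decode_encode B₂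
        rw [e0] at hB₂
        simp only [decode_nil, List.append_nil] at hB₂
        generalize (encode B₂).1 = y at hB₂
        obtain ⟨M, hM⟩ : ∃ M, r = replicate M Letter.star :=
          ⟨p + (2 + (k + y)), by
            rw [hr1, hAp, ← hB₂]
            simp only [List.replicate_add, List.append_assoc]
            rfl⟩
        obtain ⟨M, rfl⟩ : ∃ M', M = 2 + M' := ⟨M - 2, by rw [hM] at hr; simp at hr; omega⟩
        have e2 : r = [] ++ [.star, .star] ++ replicate M Letter.star := by
          rw [hM, List.replicate_add]; rfl
        have e3 : replicate M Letter.star ++ [.star, .star] = r := by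
          rw [hM, add_comm, List.replicate_add]; rfl
        refine hboth [] (replicate M Letter.star) b e2 ⟨true, ?_⟩ ⟨false, ?_⟩
        · rw [List.nil_append, List.cons_append, e3]
          simp only [reading, if_true, hW]
          exact (List.isRotated_append (l := [lit b]))
        · rw [List.nil_append, List.cons_append, e3]
          simp only [reading, hW, Bool.false_eq_true, if_false]
          rw [hM]
          simp [inv_cons, List.IsRotated.refl]
      · have hB₂ := decode_encode B₂
        rw [e0] at hB₂
        set y := (encode B₂).1
        have hWt : W = replicate (p + k + 2 + y) Letter.star ++ decode (bs ++ [(b', u)]) ++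
            [lit b] := by
          rw [hW, hr2, hAp, ← hB₂]
          simp only [List.replicate_add, List.append_assoc]
          rfl
        rw [hWt] at hτ₁ hτ₂
        have h1 : p + k + 2 + y = p + 2 + u := by
          refine leading_run_position (e := !e) (τ := τ₁) (bs := bs) (b := b) (b' := b') (by omega) ?_
          rw [show p + k + 2 + y - 2 - p = k + y by omega]
          rw [hAp, ← hB₂] at hτ₁
          simpa only [List.replicate_add, List.append_assoc] using hτ₁
        have h2 : p + k + 2 + y = (p + k) + 2 + u := by
          refine leading_run_position (e := c p') (τ := τ₂) (bs := bs) (b := b) (b' := b')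
            (by omega) ?_
          rw [show p + k + 2 + y - 2 - (p + k) = y by omega]
          rw [hAp, ← hB₂] at hτ₂
          simpa only [List.replicate_add, List.append_assoc] using hτ₂
        omega
    · have hV : A ++ replicate k Letter.star ++ lit (c p') :: B₂ ++ [.star, .star] =
          A₀ ++ lit a :: replicate (i + k) Letter.star ++ lit (c p') :: B₂ ++ [.star, .star] := by
        rw [hAi, List.replicate_add]; simp [-List.replicate_append_replicate]
      rw [hV] at hτ₂
      obtain ⟨R, hR⟩ : ∃ R, reading W τ₂ ~r replicate (i + k + 2) Letter.star ++ R := by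
        have : W = (A₀ ++ [lit a]) ++ replicate (i + k + 2) Letter.star ++ (B₂ ++ [lit b]) := by
          rw [hW, hr2, hAi, List.replicate_add, List.replicate_add]
          simp [List.replicate, -List.replicate_append_replicate]
        rw [this]
        exact reading_run τ₂
      -- Of the three readings for `q`, `A.length` and `p'`, the last two differ by the shift lemma
      -- and the first two by the count of `+`. So `q` and `p'` share a reading, and then the same
      -- letter.
      have hne : τ₁ ≠ τ₂ := by
        rintro rfl
        refine not_isRotated_of_shift (A := A₀) (a := a) (i := i) (l := k) (t := i + k + 2)
          (A' := A) (B := B₂) (B' := replicate k Letter.star ++ B₂) (e := !e) (hAi ▸ .refl _) ?_ ?_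
          (by omega) (hτ₂.trans hR) (hτ₂.trans hτ₁.symm)
        · obtain ⟨k, rfl⟩ : ∃ k', k = k' + 1 := ⟨k - 1, by omega⟩
          rw [List.replicate_succ]
          exact (List.sublist_append_right _ _).cons_cons _
        · rw [hAi]; simp; omega
      have hne' : τ ≠ τ₁ := by
        rintro rfl
        have := letter_eq_of_isRotated hA hB hn.le (hrAB.symm.trans hr1) hq hτ₁
        simp at this
      have hbool : ∀ a b c : Bool, b ≠ c → a ≠ b → a = c := by decide
      obtain rfl := hbool _ _ _ hne hne'
      have hec : e = c p' := letter_eq_of_isRotated hA hB hn.le (hrAB.symm.trans hr2) hq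
        (hV ▸ hτ₂)
      -- Were `p'` a position of the traded run before its last, its direction would be `!e`,
      -- whereas it is `c p' = e`.
      have hland : l.length ≤ k + 1 := by
        by_contra! hlt
        have h1 := hv k (by omega) (hstar (k + 1) (by omega))
        rw [hli k (by omega) (by omega), ← hp', ← hcp', ← hec] at h1
        simp at h1
      have hBB : B = replicate (k + 2 - l.length) Letter.star ++ B₂ := by
        have h1 := hrAB.symm.trans hr1
        rw [List.append_assoc, List.append_assoc] at h1
        have h2 := List.append_cancel_left h1
        have h3 : [Letter.star, .star] ++ (replicate k Letter.star ++ B₂) =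
            replicate l.length Letter.star ++ (replicate (k + 2 - l.length) Letter.star ++ B₂) := by
          rw [← List.append_assoc (replicate l.length _), ← List.replicate_add,
            show l.length + (k + 2 - l.length) = 2 + k by omega, List.replicate_add]
          simp
        rw [h3] at h2
        exact List.append_cancel_left h2
      -- At least one `*` of the run is therefore left in front of `B₂` inside `B`, and the shift
      -- lemma applies to `q` and `p'`.
      refine not_isRotated_of_shift (A := A₀) (a := a) (i := i) (l := k) (t := i + k + 2)
        (A' := A') (B := B₂) (B' := B') (e := e) (hAi ▸ hA) ?_ ?_ (by omega) (hτ₂.trans hR)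
        (hτ₂.trans hq.symm)
      · refine List.Sublist.trans ?_ hB
        rw [hBB, show k + 2 - l.length = (k + 1 - l.length) + 1 by omega, List.replicate_succ]
        exact (List.sublist_append_right _ _).cons_cons _
      · rw [hn, hBB, hAi]; simp; omega

/-! ### The universal cover of a cycle and lifting of homomorphisms -/

/-- The residue of an integer, as a vertex of an `n`-cycle. -/
def vtx (n : ℕ) [NeZero n] (z : ℤ) : Fin n :=
  ⟨(z % n).toNat, by
    have h := Int.emod_lt_of_pos z (Int.natCast_pos.2 (NeZero.pos n))
    have h' := Int.emod_nonneg z (Int.natCast_ne_zero.2 (NeZero.ne n))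
    omega⟩

theorem eq_zero_of_dvd_of_small {n : ℕ} {d : ℤ} (hn : 4 ≤ n) (h : (n : ℤ) ∣ d)
    (h1 : -4 < d) (h2 : d < 4) : d = 0 :=
  Int.eq_zero_of_abs_lt_dvd h (by rw [abs_lt]; constructor <;> omega)

variable {n : ℕ} [NeZero n]

theorem coe_vtx (z : ℤ) : ((vtx n z : ℕ) : ℤ) = z % n :=
  Int.toNat_of_nonneg (Int.emod_nonneg z (Int.natCast_ne_zero.2 (NeZero.ne n)))

theorem vtx_eq_iff {z z' : ℤ} : vtx n z = vtx n z' ↔ (n : ℤ) ∣ z' - z := by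
  rw [← Int.modEq_iff_dvd, Int.ModEq, ← coe_vtx, ← coe_vtx, Nat.cast_inj, Fin.ext_iff]

theorem vtx_coe (i : Fin n) : vtx n ((i : ℕ) : ℤ) = i := by
  apply Fin.ext
  have := coe_vtx (n := n) ((i : ℕ) : ℤ)
  rw [Int.emod_eq_of_lt (by omega) (by exact_mod_cast i.2)] at this
  exact_mod_cast this

theorem exists_vtx (i : Fin n) : ∃ z : ℤ, vtx n z = i := ⟨_, vtx_coe i⟩

theorem succ_mod_eq_iff (z z' : ℤ) :
    ((vtx n z : ℕ) + 1) % n = (vtx n z' : ℕ) ↔ (n : ℤ) ∣ z' - z - 1 := by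
  have h : (((vtx n z : ℕ) + 1) % n = (vtx n z' : ℕ)) ↔ vtx n (z + 1) = vtx n z' := by
    rw [Fin.ext_iff, ← Int.natCast_inj (n := (vtx n z' : ℕ)),
      ← Int.natCast_inj (m := (vtx n (z + 1) : ℕ)), coe_vtx (z + 1)]
    push_cast
    rw [coe_vtx z, Int.emod_add_emod]
  rw [h, vtx_eq_iff, sub_sub]

theorem IsCycle.adj_dvd {G : Digraph (Fin n)} (hG : IsCycle n G) {z z' : ℤ}
    (h : G.Adj (vtx n z) (vtx n z') ∨ G.Adj (vtx n z') (vtx n z)) :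
    (n : ℤ) ∣ z' - z ∨ (n : ℤ) ∣ z' - z - 1 ∨ (n : ℤ) ∣ z' - z + 1 := by
  by_cases he : vtx n z = vtx n z'
  · exact Or.inl (vtx_eq_iff.1 he)
  · rw [hG.adj_iff _ _ he, succ_mod_eq_iff, succ_mod_eq_iff] at h
    rcases h with h | h
    · exact Or.inr (Or.inl h)
    · right; right
      have := h.neg_right
      rwa [show -(z - z' - 1) = z' - z + 1 by ring] at this

theorem IsCycle.adj_succ {G : Digraph (Fin n)} (hG : IsCycle n G) {z z' : ℤ}
    (h : z' = z + 1 ∨ z' = z - 1) :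
    G.Adj (vtx n z) (vtx n z') ∨ G.Adj (vtx n z') (vtx n z) := by
  by_cases he : vtx n z = vtx n z'
  · rw [he]; exact Or.inl (hG.refl _)
  · rw [hG.adj_iff _ _ he, succ_mod_eq_iff, succ_mod_eq_iff]
    rcases h with rfl | rfl
    · left; ring_nf; simp
    · right; ring_nf; simp

/-- Adjacency fixes the difference modulo `n` up to `±1`, and for `n ≥ 4` a nonzero multiple of `n`
is too large to interfere. -/
theorem IsCycle.abs_sub_le {G : Digraph (Fin n)} (hG : IsCycle n G) (hn : 4 ≤ n) {z z' : ℤ}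
    (h : G.Adj (vtx n z) (vtx n z') ∨ G.Adj (vtx n z') (vtx n z)) (h2 : |z' - z| ≤ 2) :
    |z' - z| ≤ 1 := by
  rw [abs_le] at h2 ⊢
  rcases hG.adj_dvd h with h | h | h <;>
  · have := eq_zero_of_dvd_of_small hn h (by omega) (by omega)
    omega

theorem IsCycle.exists_near {G : Digraph (Fin n)} (hG : IsCycle n G) {z : ℤ} {v : Fin n}
    (h : G.Adj (vtx n z) v ∨ G.Adj v (vtx n z)) : ∃ z', vtx n z' = v ∧ |z' - z| ≤ 1 := by
  obtain ⟨y, rfl⟩ := exists_vtx v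
  rcases hG.adj_dvd h with h | h | h
  · exact ⟨z, vtx_eq_iff.2 h, by simp⟩
  · exact ⟨z + 1, vtx_eq_iff.2 (by rwa [← sub_sub]), by simp⟩
  · exact ⟨z - 1, vtx_eq_iff.2 (by rwa [← sub_add]), by simp⟩

/-- `g` lifts to a map into the universal cover of the cycle. -/
def Lifts {V : Type*} (n : ℕ) [NeZero n] (E : V → V → Prop) (g : V → Fin n) : Prop :=
  ∃ F : V → ℤ, (∀ v, vtx n (F v) = g v) ∧ ∀ u v, E u v → |F v - F u| ≤ 1

/-- Each value of `g` is lifted next to the lift of `g'`. Along an arc, the diagonal between `g'`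
and `g` first has length at most 2, hence at most 1 by adjacency; the same argument then applies to
the arc itself. -/
theorem Lifts.of_homotopic {V : Type*} {E : V → V → Prop} (hE : ∀ v, E v v) {G : Digraph (Fin n)}
    (hG : IsCycle n G) (hn : 4 ≤ n) {g g' : V → Fin n} (hg : ∀ u v, E u v → G.Adj (g u) (g v))
    (h : (∀ u v, E u v → G.Adj (g' u) (g v)) ∨ (∀ u v, E u v → G.Adj (g u) (g' v)))
    (hl : Lifts n E g') : Lifts n E g := by
  obtain ⟨F', hF', hE'⟩ := hl
  have : ∀ v, ∃ z, vtx n z = g v ∧ |z - F' v| ≤ 1 := by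
    intro v
    apply hG.exists_near
    rw [hF']
    rcases h with h | h
    · exact Or.inl (h v v (hE v))
    · exact Or.inr (h v v (hE v))
  choose F hF hFF' using this
  refine ⟨F, hF, fun u v huv => ?_⟩
  have h1 := abs_le.1 (hE' u v huv)
  have h2 := abs_le.1 (hFF' u)
  have h3 := abs_le.1 (hFF' v)
  rcases h with h | h
  · have h4 := abs_le.1 (hG.abs_sub_le hn (z := F' u) (z' := F v)
      (by rw [hF, hF']; exact Or.inl (h u v huv)) (by rw [abs_le]; constructor <;> omega))
    exact hG.abs_sub_le hn (by rw [hF, hF]; exact Or.inl (hg u v huv))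
      (by rw [abs_le]; constructor <;> omega)
  · have h4 := abs_le.1 (hG.abs_sub_le hn (z := F u) (z' := F' v)
      (by rw [hF, hF']; exact Or.inl (h u v huv)) (by rw [abs_le]; constructor <;> omega))
    exact hG.abs_sub_le hn (by rw [hF, hF]; exact Or.inl (hg u v huv))
      (by rw [abs_le]; constructor <;> omega)

/-- Retraction of a path onto an initial segment. -/
def clamp {N : ℕ} (l : ℕ) (x : Fin (N + 1)) : Fin (N + 1) :=
  ⟨min x l, lt_of_le_of_lt (min_le_left _ _) x.2⟩

theorem IsPath.adj_near {N : ℕ} {Q : Digraph (Fin (N + 1))} (hQ : IsPath N Q) {a b : Fin (N + 1)}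
    (h : Q.Adj a b) : (a : ℕ) = b ∨ (a : ℕ) + 1 = b ∨ (b : ℕ) + 1 = a := by
  by_cases he : a = b
  · exact Or.inl (by rw [he])
  · exact Or.inr ((hQ.adj_iff a b he).1 (Or.inl h))

theorem IsPath.adj_clamp {N : ℕ} {Q : Digraph (Fin (N + 1))} (hQ : IsPath N Q) {a b : Fin (N + 1)}
    (h : Q.Adj a b) (l : ℕ) : Q.Adj (clamp l a) (clamp l b) := by
  have h1 := hQ.adj_near h
  by_cases hab : (a : ℕ) ≤ l ∧ (b : ℕ) ≤ l
  · have ha : clamp l a = a := Fin.ext (min_eq_left hab.1)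
    have hb : clamp l b = b := Fin.ext (min_eq_left hab.2)
    rwa [ha, hb]
  · have : clamp l a = clamp l b := by apply Fin.ext; simp only [clamp]; omega
    rw [this]
    exact hQ.refl _

theorem IsPath.adj_clamp_succ {N : ℕ} {Q : Digraph (Fin (N + 1))} (hQ : IsPath N Q) {l : ℕ}
    (hl : l + 1 ≤ N) (h0 : Q.Adj ⟨l, by omega⟩ ⟨l + 1, by omega⟩) {a b : Fin (N + 1)}
    (h : Q.Adj a b) : Q.Adj (clamp l a) (clamp (l + 1) b) := by
  have h1 := hQ.adj_near h
  by_cases hb : (b : ℕ) ≤ l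
  · have : clamp (l + 1) b = clamp l b := by apply Fin.ext; simp only [clamp]; omega
    rw [this]; exact hQ.adj_clamp h l
  · have e1 : clamp l a = ⟨l, by omega⟩ := by apply Fin.ext; simp only [clamp]; omega
    have e2 : clamp (l + 1) b = ⟨l + 1, by omega⟩ := by apply Fin.ext; simp only [clamp]; omega
    rwa [e1, e2]

theorem IsPath.adj_succ_clamp {N : ℕ} {Q : Digraph (Fin (N + 1))} (hQ : IsPath N Q) {l : ℕ}
    (hl : l + 1 ≤ N) (h0 : Q.Adj ⟨l + 1, by omega⟩ ⟨l, by omega⟩) {a b : Fin (N + 1)}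
    (h : Q.Adj a b) : Q.Adj (clamp (l + 1) a) (clamp l b) := by
  have h1 := hQ.adj_near h
  by_cases ha : (a : ℕ) ≤ l
  · have : clamp (l + 1) a = clamp l a := by apply Fin.ext; simp only [clamp]; omega
    rw [this]; exact hQ.adj_clamp h l
  · have e1 : clamp l b = ⟨l, by omega⟩ := by apply Fin.ext; simp only [clamp]; omega
    have e2 : clamp (l + 1) a = ⟨l + 1, by omega⟩ := by apply Fin.ext; simp only [clamp]; omega
    rwa [e1, e2]

/-- Shortening one factor by its last edge is an elementary homotopy, whose direction depends on the
orientation of that edge. After finitely many shortenings the map is constant. -/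
theorem lifts_clamp {m N : ℕ} {Q : Fin m → Digraph (Fin (N + 1))} (hQ : ∀ i, IsPath N (Q i))
    {G : Digraph (Fin n)} (hG : IsCycle n G) (hn : 4 ≤ n) (f : (prodDigraph Q).Adj →r G.Adj) :
    ∀ (k : ℕ) (L : Fin m → ℕ), ∑ i, L i ≤ k → (∀ i, L i ≤ N) →
      Lifts n (prodDigraph Q).Adj (fun x => f (fun i => clamp (L i) (x i))) := by
  intro k
  induction k with
  | zero =>
    intro L hL _
    have hL0 : ∀ i, L i = 0 := by simpa using hL
    obtain ⟨z, hz⟩ := exists_vtx (f (fun _ => 0))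
    refine ⟨fun _ => z, fun v => ?_, by simp⟩
    rw [hz]
    congr 1
    funext i
    apply Fin.ext
    simp [clamp, hL0]
  | succ k ih =>
    intro L hL hLN
    by_cases hL0 : ∀ i, L i = 0
    · exact ih L (by simp [hL0]) hLN
    push Not at hL0
    obtain ⟨i, hi⟩ := hL0
    obtain ⟨l, hl⟩ := Nat.exists_eq_succ_of_ne_zero hi
    set L' := Function.update L i l
    have hle : ∀ j, L' j ≤ L j := by
      intro j
      by_cases hj : j = i
      · subst hj; simp [L', hl]
      · simp [L', hj]
    have hlt : ∑ j, L' j < ∑ j, L j :=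
      Finset.sum_lt_sum (fun j _ => hle j) ⟨i, Finset.mem_univ _, by simp [L', hl]⟩
    have hl' := ih L' (by omega) (fun j => (hle j).trans (hLN j))
    have hlN : l + 1 ≤ N := by rw [← Nat.succ_eq_add_one, ← hl]; exact hLN i
    refine Lifts.of_homotopic (fun v j => (hQ j).refl _) hG hn
      (fun u v huv => f.map_rel (fun j => (hQ j).adj_clamp (huv j) _)) ?_ hl'
    have hcase := ((hQ i).adj_iff ⟨l, by omega⟩ ⟨l + 1, by omega⟩ (by simp)).2 (Or.inl rfl)
    rcases hcase with h0 | h0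
    · refine Or.inl fun u v huv => f.map_rel fun j => ?_
      by_cases hj : j = i
      · subst hj
        simp only [L', Function.update_self, hl]
        exact (hQ j).adj_clamp_succ hlN h0 (huv j)
      · simp only [L', Function.update_of_ne hj]
        exact (hQ j).adj_clamp (huv j) _
    · refine Or.inr fun u v huv => f.map_rel fun j => ?_
      by_cases hj : j = i
      · subst hj
        simp only [L', Function.update_self, hl]
        exact (hQ j).adj_succ_clamp hlN h0 (huv j)
      · simp only [L', Function.update_of_ne hj]
        exact (hQ j).adj_clamp (huv j) _

theorem lifts_of_prod_paths {m N : ℕ} {Q : Fin m → Digraph (Fin (N + 1))}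
    (hQ : ∀ i, IsPath N (Q i)) {G : Digraph (Fin n)} (hG : IsCycle n G) (hn : 4 ≤ n)
    (f : (prodDigraph Q).Adj →r G.Adj) : Lifts n (prodDigraph Q).Adj f := by
  convert lifts_clamp hQ hG hn f _ (fun _ => N) le_rfl (fun _ => le_rfl) with x
  apply Fin.ext
  simp only [clamp]
  omega

/-- Take `u` minimizing `F`, and `v` over the residue of `F u - 1`: as `F v ≥ F u`, it is at least
`F u + n - 1`. -/
theorem exists_wide {V : Type*} [Finite V] {g : V → Fin n} {F : V → ℤ}
    (hF : ∀ v, vtx n (F v) = g v) (hg : Function.Surjective g) :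
    ∃ u v, F u + (n - 1) ≤ F v := by
  have : Nonempty V := ⟨(hg (vtx n 0)).choose⟩
  obtain ⟨u, hu⟩ := Finite.exists_min F
  obtain ⟨v, hv⟩ := hg (vtx n (F u + (n - 1)))
  refine ⟨u, v, ?_⟩
  rw [← hF, vtx_eq_iff] at hv
  have := hu v
  by_contra! hlt
  have h0 := Int.eq_zero_of_abs_lt_dvd hv (by rw [abs_lt]; constructor <;> omega)
  omega

/-! ### Words read off a cycle -/

open Classical in
/-- The letter describing the arcs between two neighbouring vertices. -/
noncomputable def between {V : Type*} (G : Digraph V) (u v : V) : Letter :=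
  if G.Adj u v then if G.Adj v u then .star else .plus else .minus

theorem between_compat_true {V : Type*} {G : Digraph V} {u v : V} :
    (between G u v).Compat true ↔ G.Adj u v := by
  unfold between Letter.Compat
  split_ifs <;> simp_all [lit]

theorem between_compat_false {V : Type*} {G : Digraph V} {u v : V}
    (h : G.Adj u v ∨ G.Adj v u) : (between G u v).Compat false ↔ G.Adj v u := by
  unfold between Letter.Compat
  split_ifs <;> simp_all [lit]

theorem between_comm {V : Type*} {G : Digraph V} {u v : V} (h : G.Adj u v ∨ G.Adj v u) :
    between G v u = (between G u v).flip := by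
  unfold between
  split_ifs <;> simp_all [Letter.flip]

/-- The word of length `k` read from the vertex `b` in the direction `ε = ±1`. -/
noncomputable def segment (G : Digraph (Fin n)) (ε b : ℤ) (k : ℕ) : Word :=
  (List.range k).map fun i : ℕ => between G (vtx n (b + ε * i)) (vtx n (b + ε * (i + 1)))

@[simp] theorem length_segment (G : Digraph (Fin n)) (ε b : ℤ) (k : ℕ) :
    (segment G ε b k).length = k := by simp [segment]

theorem getElem_segment (G : Digraph (Fin n)) (ε b : ℤ) {k i : ℕ}
    (hi : i < (segment G ε b k).length) : (segment G ε b k)[i] =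
      between G (vtx n (b + ε * i)) (vtx n (b + ε * (i + 1))) := by
  simp [segment]

theorem segment_add (G : Digraph (Fin n)) (ε b : ℤ) (k l : ℕ) :
    segment G ε b (k + l) = segment G ε b k ++ segment G ε (b + ε * k) l := by
  simp only [segment, List.range_add, List.map_append, List.map_map]
  congr 1
  apply List.map_congr_left
  intro i _
  simp only [Function.comp]
  congr 2 <;> push_cast <;> ring

theorem segment_succ (G : Digraph (Fin n)) (ε b : ℤ) (k : ℕ) :
    segment G ε b (k + 1) = between G (vtx n b) (vtx n (b + ε)) :: segment G ε (b + ε) k := by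
  rw [add_comm, segment_add]
  simp [segment]

theorem vtx_congr {z z' k : ℤ} (h : z' - z = n * k) : vtx n z = vtx n z' :=
  vtx_eq_iff.2 ⟨k, h⟩

theorem segment_rotate (G : Digraph (Fin n)) (ε b : ℤ) (k : ℕ) :
    (segment G ε b n).rotate k = segment G ε (b + ε * k) n := by
  apply List.ext_getElem (by simp)
  intro i h1 h2
  rw [List.getElem_rotate, getElem_segment, getElem_segment]
  simp only [length_segment] at h1 h2 ⊢
  have h0 := Nat.div_add_mod (i + k) n
  have h0' : (n : ℤ) * (((i + k) / n : ℕ) : ℤ) + (((i + k) % n : ℕ) : ℤ) = i + k := by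
    exact_mod_cast h0
  have e : (((i + k) % n : ℕ) : ℤ) = i + k - n * (((i + k) / n : ℕ) : ℤ) := by linarith
  rw [e]
  congr 1
  · exact vtx_congr (k := ε * (((i + k) / n : ℕ) : ℤ)) (by ring)
  · exact vtx_congr (k := ε * (((i + k) / n : ℕ) : ℤ)) (by ring)

theorem segment_congr (G : Digraph (Fin n)) (ε : ℤ) (k : ℕ) {b b' : ℤ}
    (h : vtx n b = vtx n b') : segment G ε b k = segment G ε b' k := by
  have h := vtx_eq_iff.1 h
  unfold segment
  congr 1
  funext i
  congr 1
  · exact vtx_eq_iff.2 (by simpa using h)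
  · exact vtx_eq_iff.2 (by simpa using h)

theorem segment_isRotated (G : Digraph (Fin n)) {ε : ℤ} (hε : ε = 1 ∨ ε = -1) (b b' : ℤ) :
    segment G ε b n ~r segment G ε b' n := by
  refine ⟨(vtx n (ε * (b' - b)) : ℕ), ?_⟩
  rw [segment_rotate]
  apply segment_congr
  rw [coe_vtx, vtx_eq_iff]
  have h1 := Int.emod_add_mul_ediv (ε * (b' - b)) n
  have hε2 : ε * ε = 1 := by rcases hε with rfl | rfl <;> norm_num
  refine ⟨ε * (ε * (b' - b) / n), ?_⟩
  have h2 : (ε * (b' - b)) % n = ε * (b' - b) - n * (ε * (b' - b) / n) := by linarith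
  rw [h2]
  linear_combination (-(b' - b)) * hε2

theorem exists_eq_segment (G : Digraph (Fin n)) {ε b : ℤ} {q : Word} (h : segment G ε b n ~r q) :
    ∃ b', q = segment G ε b' n := by
  obtain ⟨k, rfl⟩ := h
  exact ⟨_, segment_rotate G ε b k⟩

theorem IsCycle.adj_step {G : Digraph (Fin n)} (hG : IsCycle n G) {ε : ℤ} (hε : ε = 1 ∨ ε = -1)
    (z : ℤ) : G.Adj (vtx n z) (vtx n (z + ε)) ∨ G.Adj (vtx n (z + ε)) (vtx n z) :=
  hG.adj_succ (by rcases hε with rfl | rfl <;> simp [sub_eq_add_neg])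

theorem inv_segment {G : Digraph (Fin n)} (hG : IsCycle n G) {ε : ℤ} (hε : ε = 1 ∨ ε = -1)
    (b : ℤ) (k : ℕ) : inv (segment G ε b k) = segment G (-ε) (b + ε * k) k := by
  induction k generalizing b with
  | zero => simp [segment]
  | succ k ih =>
    rw [segment_succ, inv_cons, ih, segment_add G (-ε) _ k 1]
    congr 1
    · congr 1; push_cast; ring
    · rw [← between_comm (hG.adj_step hε b)]
      simp only [segment, List.range_one, List.map_cons, List.map_nil]
      congr 3 <;> push_cast <;> ring

theorem isCycleOf_segment {G : Digraph (Fin n)} (hG : IsCycle n G) {ε : ℤ} (hε : ε = 1 ∨ ε = -1)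
    (b : ℤ) : IsCycleOf G (segment G ε b n) := by
  set W := segment G ε b n with hW
  have hlen : W.length = n := length_segment G ε b n
  let φ : Fin W.length → Fin n := fun i => vtx n (b + ε * ((i : ℕ) : ℤ))
  have hεd : ∀ d : ℤ, (n : ℤ) ∣ ε * d ↔ (n : ℤ) ∣ d := by
    intro d
    rcases hε with rfl | rfl <;> simp
  have hφ : ∀ i j, φ i = φ j ↔ (n : ℤ) ∣ ((j : ℕ) : ℤ) - ((i : ℕ) : ℤ) := by
    intro i j
    rw [vtx_eq_iff, ← hεd (((j : ℕ) : ℤ) - ((i : ℕ) : ℤ))]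
    congr! 1
    ring
  have hinj : Function.Injective φ := by
    intro i j h
    have h0 := Int.eq_zero_of_abs_lt_dvd ((hφ i j).1 h) (by
      have := i.2; have := j.2
      rw [abs_lt]; constructor <;> omega)
    exact Fin.ext (by omega)
  have hbij : Function.Bijective φ :=
    (Fintype.bijective_iff_injective_and_card φ).2 ⟨hinj, by simp [hlen]⟩
  have hsucc : ∀ i j : Fin W.length, ((i : ℕ) + 1) % W.length = j ↔
      (n : ℤ) ∣ ((j : ℕ) : ℤ) - ((i : ℕ) : ℤ) - 1 := by
    intro i j
    rw [← succ_mod_eq_iff]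
    have hc : ∀ i : Fin W.length, (vtx n ((i : ℕ) : ℤ) : ℕ) = i := fun i =>
      congrArg Fin.val (vtx_coe (⟨i, hlen ▸ i.2⟩ : Fin n))
    rw [hc, hc, show ((i : ℕ) + 1) % W.length = ((i : ℕ) + 1) % n from congrArg _ hlen]
  have hnext : ∀ i j : Fin W.length, ((i : ℕ) + 1) % W.length = j →
      W.get i = between G (φ i) (φ j) ∧ (G.Adj (φ i) (φ j) ∨ G.Adj (φ j) (φ i)) := by
    intro i j h
    have h1 : φ j = vtx n (b + ε * (((i : ℕ) : ℤ) + 1)) := by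
      rw [eq_comm, vtx_eq_iff]
      have := (hεd _).2 ((hsucc i j).1 h)
      convert this using 1
      ring
    rw [h1]
    refine ⟨by simp only [List.get_eq_getElem]; exact getElem_segment G ε b _, ?_⟩
    have := hG.adj_step hε (b + ε * ((i : ℕ) : ℤ))
    rwa [show b + ε * ((i : ℕ) : ℤ) + ε = b + ε * (((i : ℕ) : ℤ) + 1) by ring] at this
  refine ⟨(RelIso.symm ⟨Equiv.ofBijective φ hbij, ?_⟩)⟩
  intro i j
  simp only [Equiv.ofBijective_apply]
  have ct : ∀ c : Letter, (c = .plus ∨ c = .star) ↔ c.Compat true := by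
    intro c; cases c <;> simp [Letter.Compat, lit]
  have cf : ∀ c : Letter, (c = .minus ∨ c = .star) ↔ c.Compat false := by
    intro c; cases c <;> simp [Letter.Compat, lit]
  simp only [cycleOfWord, ct, cf]
  constructor
  · intro h
    rcases hG.adj_dvd (Or.inl h) with h' | h' | h'
    · exact Or.inl (hinj (vtx_eq_iff.2 h'))
    all_goals
      rw [show b + ε * ((j : ℕ) : ℤ) - (b + ε * ((i : ℕ) : ℤ)) =
        ε * (((j : ℕ) : ℤ) - ((i : ℕ) : ℤ)) by ring] at h'
      have h2 : ((i : ℕ) + 1) % W.length = j ∨ ((j : ℕ) + 1) % W.length = i := by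
        rw [hsucc, hsucc]
        obtain ⟨t, ht⟩ := h'
        rcases hε with rfl | rfl
        all_goals first
          | exact Or.inl ⟨t, by linarith⟩
          | exact Or.inr ⟨t, by linarith⟩
          | exact Or.inl ⟨-t, by linarith⟩
          | exact Or.inr ⟨-t, by linarith⟩
      rcases h2 with h2 | h2
      · obtain ⟨h3, h4⟩ := hnext i j h2
        exact Or.inr (Or.inl ⟨h2, by rw [h3, between_compat_true]; exact h⟩)
      · obtain ⟨h3, h4⟩ := hnext j i h2
        exact Or.inr (Or.inr ⟨h2, by rw [h3, between_compat_false h4]; exact h⟩)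
  · rintro (rfl | ⟨h1, h2⟩ | ⟨h1, h2⟩)
    · exact hG.refl _
    · obtain ⟨h3, h4⟩ := hnext i j h1
      rwa [h3, between_compat_true] at h2
    · obtain ⟨h3, h4⟩ := hnext j i h1
      rwa [h3, between_compat_false h4] at h2

theorem isCycleOf_of_isRotated {G : Digraph (Fin n)} (hG : IsCycle n G) {q : Word} {b : ℤ}
    (h : ∃ τ, q ~r reading (segment G 1 b n) τ) : IsCycleOf G q := by
  obtain ⟨τ, h⟩ := h
  cases τ
  · simp only [reading, Bool.false_eq_true, if_false] at h
    rw [inv_segment hG (Or.inl rfl)] at h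
    obtain ⟨b', rfl⟩ := exists_eq_segment G h.symm
    exact isCycleOf_segment hG (Or.inr rfl) _
  · simp only [reading, if_true] at h
    obtain ⟨b', rfl⟩ := exists_eq_segment G h.symm
    exact isCycleOf_segment hG (Or.inl rfl) _

theorem segment_isRotated_reading {G : Digraph (Fin n)} (hG : IsCycle n G) {ε : ℤ}
    (hε : ε = 1 ∨ ε = -1) (b a : ℤ) : ∃ τ, segment G ε b n ~r reading (segment G 1 a n) τ := by
  rcases hε with rfl | rfl
  · exact ⟨true, segment_isRotated G (Or.inl rfl) _ _⟩
  · refine ⟨false, ?_⟩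
    simp only [reading, Bool.false_eq_true, if_false]
    rw [inv_segment hG (Or.inl rfl)]
    exact segment_isRotated G (Or.inr rfl) _ _

/-! ### Walks with prescribed directions -/

/-- One step in a given direction. -/
def Step {V : Type*} (E : V → V → Prop) : Bool → V → V → Prop
  | true, u, v => E u v
  | false, u, v => E v u

/-- There is a walk from `u` to `v` whose steps have the given directions. -/
def HasWalk {V : Type*} (E : V → V → Prop) : List Bool → V → V → Prop
  | [], u, v => u = v
  | y :: w, u, v => ∃ u', Step E y u u' ∧ HasWalk E w u' v

theorem hasWalk_prod {ι : Type*} {V : ι → Type*} {Q : (i : ι) → Digraph (V i)} :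
    ∀ {w : List Bool} {x y : (i : ι) → V i}, (∀ i, HasWalk (Q i).Adj w (x i) (y i)) →
      HasWalk (prodDigraph Q).Adj w x y
  | [], _, _, h => funext h
  | y :: w, _, _, h => by
    choose u hu hw using h
    refine ⟨u, ?_, hasWalk_prod hw⟩
    cases y
    · exact fun i => hu i
    · exact fun i => hu i

theorem between_compat_step {G : Digraph (Fin n)} (hG : IsCycle n G) {ε : ℤ}
    (hε : ε = 1 ∨ ε = -1) (z : ℤ) (y : Bool) :
    (between G (vtx n z) (vtx n (z + ε))).Compat y ↔ Step G.Adj y (vtx n z) (vtx n (z + ε)) := by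
  cases y
  · exact between_compat_false (hG.adj_step hε z)
  · exact between_compat_true

theorem hasWalk_refl {V : Type*} {E : V → V → Prop} (hE : ∀ v, E v v) (v : V) :
    ∀ w, HasWalk E w v v
  | [] => rfl
  | y :: w => ⟨v, by cases y <;> exact hE v, hasWalk_refl hE v w⟩

/-- The walk advances whenever the current letter permits it and otherwise waits on a loop. -/
theorem hasWalk_of_emb {V : Type*} {E : V → V → Prop} (hE : ∀ v, E v v) :
    ∀ {w : List Bool} {q : Word} (v : ℕ → V),
      (∀ i (hi : i < q.length) y, q[i].Compat y → Step E y (v i) (v (i + 1))) → Emb q w →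
      HasWalk E w (v 0) (v q.length)
  | w, [], v, _, _ => hasWalk_refl hE _ w
  | [], c :: q, v, _, h => by simp at h
  | y :: w, c :: q, v, hv, h => by
    rcases h with ⟨hc, h⟩ | ⟨_, h⟩
    · refine ⟨v 1, hv 0 (by simp) y hc, ?_⟩
      exact hasWalk_of_emb hE (fun i => v (i + 1))
        (fun i hi y hy => hv (i + 1) (by simpa using hi) y (by simpa using hy)) h
    · exact ⟨v 0, by cases y <;> exact hE _, hasWalk_of_emb hE v hv h⟩

/-- The lifted walk moves by at most 1 per step, so it never overtakes the greedy embedding, whose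
position is `a`; when it reaches the end of the segment, so has the greedy one. -/
theorem emb_segment_of_hasWalk {V : Type*} {E : V → V → Prop} {G : Digraph (Fin n)}
    (hG : IsCycle n G) {g : V → Fin n} (hg : ∀ u v, E u v → G.Adj (g u) (g v)) {F : V → ℤ}
    (hF : ∀ v, vtx n (F v) = g v) (hE : ∀ u v, E u v → |F v - F u| ≤ 1) :
    ∀ {w : List Bool} {k : ℕ} {a : ℤ} {u v : V}, HasWalk E w u v → F u ≤ a → a + k ≤ F v →
      Emb (segment G 1 a k) w
  | w, 0, a, u, v, _, _, _ => by simp [segment]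
  | [], k + 1, a, u, v, h, h1, h2 => by
    obtain rfl : u = v := h
    push_cast at h2
    omega
  | y :: w, k + 1, a, u, v, ⟨u', hs, hw⟩, h1, h2 => by
    have hst : |F u' - F u| ≤ 1 ∧ Step G.Adj y (vtx n (F u)) (vtx n (F u')) := by
      rw [hF, hF]
      cases y
      · exact ⟨by rw [abs_sub_comm]; exact hE _ _ hs, hg _ _ hs⟩
      · exact ⟨hE _ _ hs, hg _ _ hs⟩
    have h3 := abs_le.1 hst.1
    by_cases hc : (between G (vtx n a) (vtx n (a + 1))).Compat y
    · rw [segment_succ, emb_cons_of_compat hc]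
      exact emb_segment_of_hasWalk hG hg hF hE hw (by omega) (by push_cast at h2; omega)
    · have h4 : F u' ≤ a := by
        by_contra! hlt
        obtain rfl : F u = a := by omega
        have e : F u' = F u + 1 := by omega
        rw [e] at hst
        exact hc ((between_compat_step hG (Or.inl rfl) _ y).2 hst.2)
      have := emb_segment_of_hasWalk hG hg hF hE hw h4 h2
      rw [segment_succ] at this ⊢
      rwa [emb_cons_of_not_compat hc]

/-- A path embedded in a cycle runs around it in one direction. -/
theorem IsPath.exists_direction {N : ℕ} {Q : Digraph (Fin (N + 1))} (hQ : IsPath N Q)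
    {G : Digraph (Fin n)} (hG : IsCycle n G) (φ : Q.Adj ↪r G.Adj) :
    ∃ ε b : ℤ, (ε = 1 ∨ ε = -1) ∧ ∀ i : Fin (N + 1), φ i = vtx n (b + ε * (i : ℕ)) := by
  obtain ⟨b, hb⟩ := exists_vtx (φ 0)
  have hstep : ∀ (p : ℕ) (hp : p + 1 < N + 1) (z : ℤ), φ ⟨p, by omega⟩ = vtx n z →
      φ ⟨p + 1, hp⟩ = vtx n (z + 1) ∨ φ ⟨p + 1, hp⟩ = vtx n (z - 1) := by
    intro p hp z hz
    have h1 := (hQ.adj_iff ⟨p, by omega⟩ ⟨p + 1, hp⟩ (by simp)).2 (Or.inl rfl)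
    rw [← φ.map_rel_iff, ← φ.map_rel_iff (b := ⟨p, _⟩), hz] at h1
    obtain ⟨z', hz'⟩ := exists_vtx (φ ⟨p + 1, hp⟩)
    rw [← hz'] at h1 ⊢
    rcases hG.adj_dvd h1 with h | h | h
    · rw [← vtx_eq_iff, ← hz, hz'] at h
      have := φ.injective h
      simp at this
    · left
      rw [eq_comm, vtx_eq_iff]
      rwa [← sub_sub]
    · right
      rw [eq_comm, vtx_eq_iff]
      rwa [← sub_add]
  obtain ⟨ε, hε, h1⟩ : ∃ ε : ℤ, (ε = 1 ∨ ε = -1) ∧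
      ∀ h : 1 < N + 1, φ ⟨1, h⟩ = vtx n (b + ε) := by
    by_cases h : 1 < N + 1
    · rcases hstep 0 h b hb.symm with h1 | h1
      · exact ⟨1, Or.inl rfl, fun _ => h1⟩
      · exact ⟨-1, Or.inr rfl, fun _ => h1⟩
    · exact ⟨1, Or.inl rfl, fun h' => absurd h' h⟩
  refine ⟨ε, b, hε, ?_⟩
  have key : ∀ p : ℕ, (∀ h : p < N + 1, φ ⟨p, h⟩ = vtx n (b + ε * p)) ∧
      ∀ h : p + 1 < N + 1, φ ⟨p + 1, h⟩ = vtx n (b + ε * (p + 1 : ℕ)) := by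
    intro p
    induction p with
    | zero =>
      refine ⟨fun h => ?_, fun h => ?_⟩
      · simpa using hb.symm
      · simpa using h1 h
    | succ p ih =>
      refine ⟨ih.2, fun h => ?_⟩
      have h2 := hstep (p + 1) h _ (ih.2 (by omega))
      have h3 : φ ⟨p + 1 + 1, h⟩ = vtx n (b + ε * (p + 1 : ℕ) + ε) ∨
          φ ⟨p + 1 + 1, h⟩ = vtx n (b + ε * (p + 1 : ℕ) - ε) := by
        rcases hε with rfl | rfl
        · exact h2
        · rcases h2 with h2 | h2
          · exact Or.inr (by rw [h2, sub_neg_eq_add])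
          · exact Or.inl h2
      rcases h3 with h3 | h3
      · rw [h3]; congr 1; push_cast; ring
      · have h4 : φ ⟨p + 1 + 1, h⟩ = φ ⟨p, by omega⟩ := by
          rw [h3, ih.1 (by omega)]; congr 1; push_cast; ring
        have := φ.injective h4
        simp at this
        omega
  intro i
  exact (key i).1 i.2

/-- The steps from `x` to `y` form a prefix of a word of `n - 2` steps of the cycle, which is a
reading with two letters removed and so embeds in `w`. As this holds for any endpoints, the walks in
the factors combine into one in the product. -/
theorem IsPath.hasWalk {N : ℕ} (hN : n = N + 2) {Q : Digraph (Fin (N + 1))} (hQ : IsPath N Q)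
    {G : Digraph (Fin n)} (hG : IsCycle n G) (φ : Q.Adj ↪r G.Adj) {w : List Bool} {a : ℤ}
    (hw : ∀ q y z, (∃ τ, q ++ [y, z] ~r reading (segment G 1 a n) τ) → Emb q w)
    (x y : Fin (N + 1)) : HasWalk Q.Adj w x y := by
  obtain ⟨ε₀, b₀, hε₀, hφ⟩ := hQ.exists_direction hG φ
  obtain ⟨ε, b, l, v, hε, hl, hv0, hvl, hv⟩ : ∃ (ε b : ℤ) (l : ℕ) (v : ℕ → Fin (N + 1)),
      (ε = 1 ∨ ε = -1) ∧ l ≤ N ∧ v 0 = x ∧ v l = y ∧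
      ∀ i ≤ l, φ (v i) = vtx n (b + ε * (i : ℕ)) := by
    rcases le_total (x : ℕ) y with hxy | hxy
    · refine ⟨ε₀, b₀ + ε₀ * (x : ℕ), y - x, fun i => ⟨min (x + i) N, by omega⟩, hε₀, by omega, ?_, ?_,
        ?_⟩
      · apply Fin.ext; simp only; omega
      · apply Fin.ext; simp only; omega
      · intro i hi
        rw [hφ]
        congr 1
        simp only
        rw [min_eq_left (by omega)]
        push_cast; ring
    · refine ⟨-ε₀, b₀ + ε₀ * (x : ℕ), x - y, fun i => ⟨x - i, by omega⟩, by omega, by omega, ?_, ?_,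
        ?_⟩
      · apply Fin.ext; simp
      · apply Fin.ext; simp only; omega
      · intro i hi
        rw [hφ]
        congr 1
        simp only
        rw [Nat.cast_sub (by omega)]
        ring
  have hemb : Emb (segment G ε b l) w := by
    obtain ⟨k, rfl⟩ : ∃ k, N = l + k := ⟨N - l, by omega⟩
    have h2 : Emb (segment G ε b (l + k)) w := by
      obtain ⟨τ, hτ⟩ := segment_isRotated_reading hG hε b a
      have e : segment G ε b n = segment G ε b (l + k) ++ segment G ε (b + ε * (l + k : ℕ)) 2 := by
        conv_lhs => rw [show segment G ε b n = segment G ε b (l + k + 2) from congrArg _ hN]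
        exact segment_add _ _ _ _ _
      rw [e, segment_succ, segment_succ] at hτ
      exact hw _ _ _ ⟨τ, by simpa [segment] using hτ⟩
    rw [segment_add] at h2
    exact emb_prefix h2
  have := hasWalk_of_emb (E := Q.Adj) hQ.refl v ?_ hemb
  · rwa [length_segment, hv0, hvl] at this
  · intro i hi d hc
    rw [getElem_segment] at hc
    rw [length_segment] at hi
    have e : b + ε * ((i : ℤ) + 1) = b + ε * i + ε := by ring
    rw [e, between_compat_step hG hε] at hc
    have h1 := hv i hi.le
    have h2 := hv (i + 1) hi
    rw [show b + ε * ((i + 1 : ℕ) : ℤ) = b + ε * i + ε by push_cast; ring] at h2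
    rw [← h1, ← h2] at hc
    cases d
    · exact φ.map_rel_iff.1 hc
    · exact φ.map_rel_iff.1 hc

/-! ### Conclusion -/

theorem exists_isCycleOf {G : Digraph (Fin n)} (hn : 4 ≤ n) (hG : IsCycle n G)
    (hfail : ¬ PathCondition n G) :
    ∃ A B : Word, IsCycleOf G (A ++ [.star, .star] ++ B ++ [.plus]) ∧
      IsCycleOf G (A ++ [.plus] ++ B ++ [.star, .star]) ∧
      IsCycleOf G (A ++ [.minus] ++ B ++ [.star, .star]) := by
  obtain ⟨m, Q, hQ, hφ, f, hf⟩ := not_not.1 hfail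
  obtain ⟨F, hF, hFE⟩ := lifts_of_prod_paths hQ hG hn f
  obtain ⟨u, v, huv⟩ := exists_wide hF hf
  set r := segment G 1 (F u) (n - 1)
  set x := between G (vtx n (F u + (n - 1 : ℕ))) (vtx n (F u + (n - 1 : ℕ) + 1))
  have hW : r ++ [x] = segment G 1 (F u) n := by
    conv_rhs => rw [show segment G 1 (F u) n = segment G 1 (F u) (n - 1 + 1) from
      congrArg _ (by omega)]
    rw [segment_add, segment_succ]
    simp [segment, r, x]
  have H : ∀ w, (∀ q y z, (∃ τ, q ++ [y, z] ~r reading (r ++ [x]) τ) → Emb q w) → Emb r w := by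
    intro w hw
    rw [hW] at hw
    refine emb_segment_of_hasWalk hG (fun _ _ h => f.map_rel h) hF hFE (u := u) (v := v)
      (hasWalk_prod fun i => ?_) le_rfl (by push_cast [Nat.cast_sub (by omega : 1 ≤ n)]; exact huv)
    exact (hQ i).hasWalk (by omega) hG (hφ i).some hw _ _
  obtain ⟨A, B, b, hx, hr, hAB⟩ := exists_double_star (by simp [r]; omega) H
  have hrot : ∀ {q : Word}, (∃ τ, q ~r reading (r ++ [x]) τ) → IsCycleOf G q := by
    rw [hW]
    exact fun h => isCycleOf_of_isRotated hG h
  have hinv : ∀ {q : Word}, (∃ τ, q ~r reading (r ++ [x]) τ) → IsCycleOf G (inv q) := by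
    rintro q ⟨τ, h⟩
    refine hrot ⟨!τ, ?_⟩
    have := isRotated_inv h
    cases τ
    · simpa [reading] using this
    · simpa [reading] using this
  have h0 : ∃ τ, A ++ [.star, .star] ++ B ++ [lit b] ~r reading (r ++ [x]) τ := by
    rw [hx, hr]
    exact ⟨true, .refl _⟩
  cases b
  -- If the remaining letter is `-`, reading the cycle backwards turns it into `+`, and `inv B`,
  -- `inv A` take the roles of `A`, `B`.
  · have hrot2 : ∀ {p q s : Word}, (∃ τ, p ++ q ++ s ~r reading (r ++ [x]) τ) →
        ∃ τ, s ++ p ++ q ~r reading (r ++ [x]) τ := by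
      rintro p q s ⟨τ, h⟩
      refine ⟨τ, .trans ?_ h⟩
      rw [List.append_assoc]
      exact List.isRotated_append
    refine ⟨inv B, inv A, ?_, ?_, ?_⟩
    · have := hinv (hrot2 (p := A ++ [.star, .star]) h0)
      simpa [inv, Letter.flip, lit] using this
    · have := hinv (hrot2 (p := A) (q := lit false :: B) (hAB false))
      simpa [inv, Letter.flip, lit] using this
    · have := hinv (hrot2 (p := A) (q := lit true :: B) (hAB true))
      simpa [inv, Letter.flip, lit] using this
  · exact ⟨A, B, hrot h0, by simpa [lit] using hrot (hAB true),
      by simpa [lit] using hrot (hAB false)⟩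

end ReflexiveCycles

theorem theorem4p6 (n : ℕ) (hn : 4 ≤ n) (G : Digraph (Fin n))
    (hG : ReflexiveCycles.IsCycle n G) (hfail : ¬ ReflexiveCycles.PathCondition n G) :
    ∃ A B : ReflexiveCycles.Word,
      ReflexiveCycles.IsCycleOf G (A ++ [.star, .star] ++ B ++ [.plus]) ∧
      ReflexiveCycles.IsCycleOf G (A ++ [.plus] ++ B ++ [.star, .star]) ∧
      ReflexiveCycles.IsCycleOf G (A ++ [.minus] ++ B ++ [.star, .star]) := by
  have : NeZero n := ⟨by omega⟩
  exact ReflexiveCycles.exists_isCycleOf hn hG hfail
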